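/- Let $M$ be a smooth finite-dimensional real manifold (without boundary), $\Lambda$ a bivector field, $E$ a vector field and $\omega$ a $2$-form on $M$, all smooth. **Conventions.** $\Lambda^\#$ is given by $\langle\beta,\Lambda^\#(\alpha)\rangle=\Lambda(\alpha,\beta)$. A pair $(P,Q)$ of a $k$-vector field (or $k$-form) and a $(k-1)$-vector field (or $(k-1)$-form) is regarded as a section of $\bigwedge^k(TM\times\mathbb R)$ (or $\bigwedge^k(T^*M\times\mathbb R)$) by $(P,Q)((\alpha_1,f_1),\dots,(\alpha_k,f_k))=P(\alpha_1,\dots,\alpha_k)+\sum_i(-1)^{i+1}f_i\,Q(\alpha_1,\dots,\widehat{\alpha_i},\dots,\alpha_k)$. Put $(\Lambda,E)^\#(\alpha,f)=(\Lambda^\#(\alpha)+fE,\,-\langle\alpha,E\rangle)$ and, for a section $\eta$ of $\bigwedge^k(T^*M\times\mathbb R)$, $(\Lambda,E)^\#(\eta)(a_1,\dots,a_k)=(-1)^k\eta((\Lambda,E)^\#a_1,\dots,(\Lambda,E)^\#a_k)$. Let $[\cdot,\cdot]$ be the Schouten bracket of the Lie algebroid $TM\times\mathbb R$, whose anchor is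 the projection to $TM$ and whose bracket of sections is $[(X,f),(Y,g)]=([X,Y],X(g)-Y(f))$, normalised by $[P,Q\wedge R]=[P,Q]\wedge R+(-1)^{(p-1)q}Q\wedge[P,R]$; for $P,Q$ of degrees $p,q$ and the $1$-cocycle $\phi=(0,1)$ put $[P,Q]^{(0,1)}=[P,Q]+(p-1)P\wedge i_\phi Q+(-1)^p(q-1)\,i_\phi P\wedge Q$. Assume that $((\Lambda,E),\omega)$ is a twisted Jacobi structure, that is, $$\tfrac12[(\Lambda,E),(\Lambda,E)]^{(0,1)}=(\Lambda,E)^\#(d\omega,\omega),$$ and that it is transitive: at every $x\in M$ the image of the anchor $(\alpha,f)\mapsto\Lambda^\#(\alpha)+fE$, $T_x^*M\times\mathbb R\to T_xM$, has dimension $\dim M$ (is all of $T_xM$). 1) If $\dim M$ is even, then $((\Lambda,E),\omega)$ comes from a twisted locally conformal symplectic structure: there are a smooth $1$-form $\vartheta$ and a smooth non-degenerate $2$-form $\Theta$ on $M$ with $$d\vartheta=0,\qquad d(\Theta-\omega)+\vartheta\wedge(\Theta-\omega)=0,$$ such that $i(E)\Theta=-\vartheta$ and $i(\Lambda^\#(\alpha))\Theta=-\alpha$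 for all covectors $\alpha$; moreover $E=\Lambda^\#(\vartheta)$. 2) If $\dim M=2n+1$ is odd, then $((\Lambda,E),\omega)$ comes from a twisted contact structure: there is a smooth $1$-form $\vartheta$ on $M$ such that, with $\Theta=d\vartheta+\omega$, the form $\vartheta\wedge\Theta^n$ vanishes nowhere, and $$i(E)\vartheta=1,\quad i(E)\Theta=0,\quad \Lambda^\#(\vartheta)=0,\quad i(\Lambda^\#(\alpha))\Theta=-(\alpha-\langle\alpha,E\rangle\vartheta)\ \text{ for all covectors }\alpha.$$ -/

import Mathlib

open scoped Manifold

noncomputable section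

namespace TwistedJacobi

/-! ### Exterior algebra

A `k`-form on a space `U` is an alternating map `U [⋀^Fin k]→L[ℝ] ℝ`, and a `k`-vector on `U` is an
alternating map on the dual of `U`. -/

section Algebra

theorem update_castAdd_left {U : Type*} {p q : ℕ} [DecidableEq (Fin (p + q))] (v : Fin (p + q) → U)
    (i : Fin p) (x : U) :
    (fun k => Function.update v (Fin.castAdd q i) x (Fin.castAdd q k)) =
      Function.update (fun k => v (Fin.castAdd q k)) i x :=
  Function.update_comp_eq_of_injective' v (Fin.castAdd_injective p q) i x

theorem update_natAdd_right {U : Type*} {p q : ℕ} [DecidableEq (Fin (p + q))] (v : Fin (p + q) → U)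
    (i : Fin q) (x : U) :
    (fun k => Function.update v (Fin.natAdd p i) x (Fin.natAdd p k)) =
      Function.update (fun k => v (Fin.natAdd p k)) i x :=
  Function.update_comp_eq_of_injective' v (Fin.natAdd_injective q p) i x

theorem update_castAdd_right {U : Type*} {p q : ℕ} [DecidableEq (Fin (p + q))] (v : Fin (p + q) → U)
    (i : Fin p) (x : U) :
    (fun k => Function.update v (Fin.castAdd q i) x (Fin.natAdd p k)) =
      fun k => v (Fin.natAdd p k) := by
  funext k
  refine Function.update_of_ne (fun h => ?_) _ _
  have := congrArg Fin.val h
  simp at this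
  omega

theorem update_natAdd_left {U : Type*} {p q : ℕ} [DecidableEq (Fin (p + q))] (v : Fin (p + q) → U)
    (i : Fin q) (x : U) :
    (fun k => Function.update v (Fin.natAdd p i) x (Fin.castAdd q k)) =
      fun k => v (Fin.castAdd q k) := by
  funext k
  refine Function.update_of_ne (fun h => ?_) _ _
  have := congrArg Fin.val h
  simp at this
  omega

variable {U U' : Type*} [AddCommGroup U] [Module ℝ U] [TopologicalSpace U]
  [AddCommGroup U'] [Module ℝ U'] [TopologicalSpace U']

/-- Change of the name of the degree. -/
def castDegree {m n : ℕ} (h : m = n) (a : U [⋀^Fin m]→L[ℝ] ℝ) : U [⋀^Fin n]→L[ℝ] ℝ := h ▸ a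

/-- The product `(v₁, …, v_{p+q}) ↦ a (v₁, …, v_p) * b (v_{p+1}, …, v_{p+q})`. -/
def tensor {p q : ℕ} (a : U [⋀^Fin p]→L[ℝ] ℝ) (b : U [⋀^Fin q]→L[ℝ] ℝ) :
    ContinuousMultilinearMap ℝ (fun _ : Fin (p + q) => U) ℝ where
  toFun v := a (fun i => v (Fin.castAdd q i)) * b (fun j => v (Fin.natAdd p j))
  map_update_add' v i x y := by
    classical
    induction i using Fin.addCases with
    | left i => simp [update_castAdd_left, update_castAdd_right, add_mul]
    | right i => simp [update_natAdd_left, update_natAdd_right, mul_add]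
  map_update_smul' v i c x := by
    classical
    induction i using Fin.addCases with
    | left i => simp [update_castAdd_left, update_castAdd_right, mul_assoc]
    | right i => simp [update_natAdd_left, update_natAdd_right, mul_left_comm]
  cont := by
    refine Continuous.mul (a.cont.comp ?_) (b.cont.comp ?_) <;> fun_prop

/-- The wedge product
`(a ∧ b)(v₁, …, v_{p+q}) = 1/(p! q!) ∑_σ sign σ • a(v_{σ 1}, …, v_{σ p}) b(v_{σ (p+1)}, …)`. -/
def wedge {p q : ℕ} (a : U [⋀^Fin p]→L[ℝ] ℝ) (b : U [⋀^Fin q]→L[ℝ] ℝ) :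
    U [⋀^Fin (p + q)]→L[ℝ] ℝ :=
  ((p.factorial : ℝ) * (q.factorial : ℝ))⁻¹ • ContinuousMultilinearMap.alternatization (tensor a b)

/-- The wedge power `a ∧ ⋯ ∧ a` (`n` factors) of a `2`-form. -/
def wedgePow (a : U [⋀^Fin 2]→L[ℝ] ℝ) : (n : ℕ) → U [⋀^Fin (2 * n)]→L[ℝ] ℝ
  | 0 => ContinuousAlternatingMap.constOfIsEmpty ℝ U (Fin 0) (1 : ℝ)
  | n + 1 => wedge (wedgePow a n) a

/-- A linear form as an alternating map in one variable. -/
def oneForm (α : U →L[ℝ] ℝ) : U [⋀^Fin 1]→L[ℝ] ℝ :=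
  ContinuousAlternatingMap.ofSubsingleton ℝ U ℝ (0 : Fin 1) α

/-- Contraction of the first slot: `(ι_u a)(v₁, …, v_k) = a(u, v₁, …, v_k)`. -/
def contract {k : ℕ} (u : U) (a : U [⋀^Fin (k + 1)]→L[ℝ] ℝ) : U [⋀^Fin k]→L[ℝ] ℝ where
  toFun v := a (Matrix.vecCons u v)
  map_update_add' := @fun inst v i x y => by
    obtain rfl := Subsingleton.elim inst (instDecidableEqFin k)
    simp only [Matrix.vecCons, Fin.cons_update]
    exact a.map_update_add _ _ _ _
  map_update_smul' := @fun inst v i c x => by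
    obtain rfl := Subsingleton.elim inst (instDecidableEqFin k)
    simp only [Matrix.vecCons, Fin.cons_update]
    exact a.map_update_smul _ _ _ _
  map_eq_zero_of_eq' v i j h hij :=
    a.map_eq_zero_of_eq (Matrix.vecCons u v) (i := i.succ) (j := j.succ) (by simpa using h)
      (fun e => hij (Fin.succ_injective k e))
  cont := by
    refine a.cont.comp (continuous_pi fun i => ?_)
    refine Fin.cases ?_ (fun j => ?_) i
    · exact continuous_const
    · exact continuous_apply j

/-- The pair `(a, b)` of an alternating map of degree `k + 1` and one of degree `k` on `U`, as an
alternating map of degree `k + 1` on `U × ℝ`: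
`(a, b)((u₀, f₀), …, (u_k, f_k)) = a(u₀, …, u_k) + ∑ᵢ (-1)ⁱ fᵢ b(u₀, …, ûᵢ, …, u_k)`. -/
def pair {k : ℕ} (a : U [⋀^Fin (k + 1)]→L[ℝ] ℝ) (b : U [⋀^Fin k]→L[ℝ] ℝ) :
    (U × ℝ) [⋀^Fin (k + 1)]→L[ℝ] ℝ :=
  a.compContinuousLinearMap (ContinuousLinearMap.fst ℝ U ℝ) +
    castDegree (Nat.add_comm 1 k) (wedge (oneForm (ContinuousLinearMap.snd ℝ U ℝ))
      (b.compContinuousLinearMap (ContinuousLinearMap.fst ℝ U ℝ)))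

/-- The map `(α, f) ↦ (α ∘ T, f)` from `U'* × ℝ` to `U* × ℝ` induced by `T : U → U'`. -/
def dualProd (T : U →L[ℝ] U') : ((U' →L[ℝ] ℝ) × ℝ) →L[ℝ] ((U →L[ℝ] ℝ) × ℝ) :=
  (ContinuousLinearMap.precomp ℝ T).prodMap (ContinuousLinearMap.id ℝ ℝ)

/-- Evaluation of covectors at `u`, that is `u` as a `1`-vector. -/
def evalAt [ContinuousSMul ℝ U] (u : U) : (U →L[ℝ] ℝ) →L[ℝ] ℝ where
  toFun α := α u
  map_add' _ _ := rfl
  map_smul' _ _ := rfl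
  cont := continuous_eval_const u

theorem two_add_left (B : U [⋀^Fin 2]→L[ℝ] ℝ) (a b c : U) :
    B ![a + b, c] = B ![a, c] + B ![b, c] := by
  have e : ∀ z, Function.update ![0, c] 0 z = ![z, c] := fun z => by
    ext i; fin_cases i <;> rfl
  simpa only [e] using B.map_update_add ![0, c] 0 a b

theorem two_smul_left (B : U [⋀^Fin 2]→L[ℝ] ℝ) (r : ℝ) (a c : U) :
    B ![r • a, c] = r * B ![a, c] := by
  have e : ∀ z, Function.update ![0, c] 0 z = ![z, c] := fun z => by
    ext i; fin_cases i <;> rfl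
  simpa only [e, smul_eq_mul] using B.map_update_smul ![0, c] 0 r a

theorem two_add_right (B : U [⋀^Fin 2]→L[ℝ] ℝ) (a b c : U) :
    B ![c, a + b] = B ![c, a] + B ![c, b] := by
  have e : ∀ z, Function.update ![c, 0] 1 z = ![c, z] := fun z => by
    ext i; fin_cases i <;> rfl
  simpa only [e] using B.map_update_add ![c, 0] 1 a b

theorem two_smul_right (B : U [⋀^Fin 2]→L[ℝ] ℝ) (r : ℝ) (a c : U) :
    B ![c, r • a] = r * B ![c, a] := by
  have e : ∀ z, Function.update ![c, 0] 1 z = ![c, z] := fun z => by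
    ext i; fin_cases i <;> rfl
  simpa only [e, smul_eq_mul] using B.map_update_smul ![c, 0] 1 r a

variable [IsTopologicalAddGroup U] [ContinuousSMul ℝ U] [T2Space U] [FiniteDimensional ℝ U]

/-- The functional `β ↦ Λ (α, β)` on the dual of `U`. -/
def pairingWith (Λ : (U →L[ℝ] ℝ) [⋀^Fin 2]→L[ℝ] ℝ) (α : U →L[ℝ] ℝ) :
    Module.Dual ℝ (Module.Dual ℝ U) where
  toFun β := Λ ![α, LinearMap.toContinuousLinearMap β]
  map_add' β γ := by rw [map_add, two_add_right]
  map_smul' c β := by rw [map_smul, two_smul_right]; rfl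

/-- The morphism `Λ^# : U* → U` of a bivector `Λ`, determined by `β (Λ^# α) = Λ (α, β)`. -/
def sharp (Λ : (U →L[ℝ] ℝ) [⋀^Fin 2]→L[ℝ] ℝ) : (U →L[ℝ] ℝ) →ₗ[ℝ] U where
  toFun α := (Module.evalEquiv ℝ U).symm (pairingWith Λ α)
  map_add' α β := by
    rw [← map_add]
    congr 1
    ext γ
    exact two_add_left Λ _ _ _
  map_smul' c α := by
    rw [RingHom.id_apply, ← map_smul]
    congr 1
    ext γ
    exact two_smul_left Λ _ _ _

theorem apply_sharp (Λ : (U →L[ℝ] ℝ) [⋀^Fin 2]→L[ℝ] ℝ) (α β : U →L[ℝ] ℝ) :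
    β (sharp Λ α) = Λ ![α, β] :=
  Module.apply_evalEquiv_symm_apply ℝ U (β : U →ₗ[ℝ] ℝ) (pairingWith Λ α)

/-- `(Λ, E)^# (α, f) = (Λ^# α + f E, - α(E))`. -/
def jacobiSharp (Λ : (U →L[ℝ] ℝ) [⋀^Fin 2]→L[ℝ] ℝ) (E : U) :
    ((U →L[ℝ] ℝ) × ℝ) →ₗ[ℝ] (U × ℝ) where
  toFun a := (sharp Λ a.1 + a.2 • E, - a.1 E)
  map_add' a b := by
    ext
    · simp only [Prod.fst_add, Prod.snd_add, map_add, add_smul]; abel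
    · simp; ring
  map_smul' c a := by
    ext <;> simp [mul_smul]

/-- The extension of `(Λ, E)^#` to alternating maps of degree `k`:
`(Λ, E)^#(η)(a₁, …, a_k) = (-1)^k η((Λ, E)^# a₁, …, (Λ, E)^# a_k)`. -/
def jacobiSharpExt {k : ℕ} (Λ : (U →L[ℝ] ℝ) [⋀^Fin 2]→L[ℝ] ℝ) (E : U)
    (η : (U × ℝ) [⋀^Fin k]→L[ℝ] ℝ) (a : Fin k → (U →L[ℝ] ℝ) × ℝ) : ℝ :=
  (-1 : ℝ) ^ k * η (fun i => jacobiSharp Λ E (a i))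

end Algebra

/-! ### Tensor fields on a manifold

`M` is a manifold without boundary modelled on the finite-dimensional space `V`. -/

section Manifold

variable {V : Type*} [NormedAddCommGroup V] [NormedSpace ℝ V]
  {M : Type*} [TopologicalSpace M] [ChartedSpace V M]

instance [FiniteDimensional ℝ V] (x : M) : FiniteDimensional ℝ (TangentSpace 𝓘(ℝ, V) x) :=
  inferInstanceAs (FiniteDimensional ℝ V)

instance (x : M) : T2Space (TangentSpace 𝓘(ℝ, V) x) :=
  inferInstanceAs (T2Space V)

variable (V M) in
/-- Differential forms of degree `k` (no smoothness imposed). -/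
abbrev Form (k : ℕ) := (x : M) → TangentSpace 𝓘(ℝ, V) x [⋀^Fin k]→L[ℝ] ℝ

variable (V M) in
/-- Fields of covectors (no smoothness imposed). -/
abbrev CovectorField := (x : M) → TangentSpace 𝓘(ℝ, V) x →L[ℝ] ℝ

variable (V M) in
/-- Vector fields (no smoothness imposed). -/
abbrev VField := (x : M) → TangentSpace 𝓘(ℝ, V) x

variable (V M) in
/-- Bivector fields (no smoothness imposed). -/
abbrev BivectorField :=
  (x : M) → (TangentSpace 𝓘(ℝ, V) x →L[ℝ] ℝ) [⋀^Fin 2]→L[ℝ] ℝ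

variable (V M) in
/-- Sections of `⋀ᵏ(TM × ℝ)` (no smoothness imposed), as alternating maps on `T*M × ℝ`. -/
abbrev MultiSection (k : ℕ) :=
  (x : M) → ((TangentSpace 𝓘(ℝ, V) x →L[ℝ] ℝ) × ℝ) [⋀^Fin k]→L[ℝ] ℝ

/-- The differential at `x` of the chart centred at `x₀`. -/
def chartDeriv (x₀ x : M) : TangentSpace 𝓘(ℝ, V) x →L[ℝ] V :=
  (NormedSpace.fromTangentSpace (extChartAt 𝓘(ℝ, V) x₀ x)).toContinuousLinearMap ∘L
    mfderiv 𝓘(ℝ, V) 𝓘(ℝ, V) (extChartAt 𝓘(ℝ, V) x₀) x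

/-- The differential at `y` of the inverse of the chart centred at `x₀`. -/
def chartSymmDeriv (x₀ : M) (y : V) :
    V →L[ℝ] TangentSpace 𝓘(ℝ, V) ((extChartAt 𝓘(ℝ, V) x₀).symm y) :=
  mfderiv 𝓘(ℝ, V) 𝓘(ℝ, V) (extChartAt 𝓘(ℝ, V) x₀).symm y ∘L
    (NormedSpace.fromTangentSpace y).symm.toContinuousLinearMap

/-- The coordinate expression of a form in the chart centred at `x₀`: its pullback under the
inverse of the chart. -/
def Form.inChart {k : ℕ} (η : Form V M k) (x₀ : M) (y : V) : V [⋀^Fin k]→L[ℝ] ℝ :=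
  (η ((extChartAt 𝓘(ℝ, V) x₀).symm y)).compContinuousLinearMap (chartSymmDeriv x₀ y)

/-- The coordinate expression of a section of `⋀ᵏ(TM × ℝ)` in the chart centred at `x₀`: its
pushforward under the chart. -/
def MultiSection.inChart {k : ℕ} (P : MultiSection V M k) (x₀ : M) (y : V) :
    ((V →L[ℝ] ℝ) × ℝ) [⋀^Fin k]→L[ℝ] ℝ :=
  (P ((extChartAt 𝓘(ℝ, V) x₀).symm y)).compContinuousLinearMap
    (dualProd (chartDeriv x₀ ((extChartAt 𝓘(ℝ, V) x₀).symm y)))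

/-- Smooth differential forms. -/
def Form.IsSmooth {k : ℕ} (η : Form V M k) : Prop :=
  ∀ x₀ : M, ContDiffOn ℝ (⊤ : ℕ∞) (η.inChart x₀) (extChartAt 𝓘(ℝ, V) x₀).target

/-- Smooth sections of `⋀ᵏ(TM × ℝ)`. -/
def MultiSection.IsSmooth {k : ℕ} (P : MultiSection V M k) : Prop :=
  ∀ x₀ : M, ContDiffOn ℝ (⊤ : ℕ∞) (P.inChart x₀) (extChartAt 𝓘(ℝ, V) x₀).target

/-- The exterior derivative of a form on `M`, computed at `x` in the chart centred at `x`. -/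
def Form.d {k : ℕ} (η : Form V M k) : Form V M (k + 1) := fun x =>
  (extDeriv (η.inChart x) (extChartAt 𝓘(ℝ, V) x x)).compContinuousLinearMap (chartDeriv x x)

/-- A field of covectors as a form of degree `1`. -/
def CovectorField.toForm (ϑ : CovectorField V M) : Form V M 1 := fun x => oneForm (ϑ x)

/-- The section `(Λ, E)` of `⋀²(TM × ℝ)`:
`(Λ, E)((α, f), (β, g)) = Λ(α, β) + f β(E) - g α(E)`. -/
def jacobiSection (Λ : BivectorField V M) (E : VField V M) : MultiSection V M 2 := fun x =>
  pair (Λ x) (oneForm (evalAt (E x)))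

variable [FiniteDimensional ℝ V]

/-- The Schouten bracket of the Lie algebroid `TM × ℝ`, with
`[(X, f), (Y, g)] = ([X, Y], X(g) - Y(f))`, in a chart. For coordinates `x^a` on `V`, the sections
`∂_a = (∂/∂x^a, 0)` and `(0, 1)` form a frame with vanishing brackets, the anchor of `(0, 1)` is
zero, and
`[P, Q] = ∑_a ((-1)^(deg P - 1) ι_{dx^a} P ∧ ∂_a Q - ∂_a P ∧ ι_{dx^a} Q)`.
It extends the Lie bracket of sections and satisfies
`[P, Q ∧ R] = [P, Q] ∧ R + (-1)^((deg P - 1) deg Q) Q ∧ [P, R]`. -/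
def schoutenFlat {p q : ℕ} (P : V → ((V →L[ℝ] ℝ) × ℝ) [⋀^Fin (p + 1)]→L[ℝ] ℝ)
    (Q : V → ((V →L[ℝ] ℝ) × ℝ) [⋀^Fin (q + 1)]→L[ℝ] ℝ) (y : V) :
    ((V →L[ℝ] ℝ) × ℝ) [⋀^Fin (p + q + 1)]→L[ℝ] ℝ :=
  ∑ a, ((-1 : ℝ) ^ p •
      wedge (contract (dx a) (P y)) (fderiv ℝ Q y (Module.finBasis ℝ V a)) -
    castDegree (Nat.add_right_comm p 1 q)
      (wedge (fderiv ℝ P y (Module.finBasis ℝ V a)) (contract (dx a) (Q y))))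
where
  /-- The section `(dx^a, 0)` of `T*V × ℝ`. -/
  dx (a : Fin (Module.finrank ℝ V)) : (V →L[ℝ] ℝ) × ℝ :=
    (LinearMap.toContinuousLinearMap ((Module.finBasis ℝ V).coord a), 0)

/-- The Schouten bracket modified by the `1`-cocycle `κ` of `TM × ℝ`, in a chart:
`[P, Q]^κ = [P, Q] + (deg P - 1) P ∧ ι_κ Q + (-1)^(deg P) (deg Q - 1) ι_κ P ∧ Q`. -/
def schoutenFlatMod {p q : ℕ} (κ : (V →L[ℝ] ℝ) × ℝ)
    (P : V → ((V →L[ℝ] ℝ) × ℝ) [⋀^Fin (p + 1)]→L[ℝ] ℝ)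
    (Q : V → ((V →L[ℝ] ℝ) × ℝ) [⋀^Fin (q + 1)]→L[ℝ] ℝ) (y : V) :
    ((V →L[ℝ] ℝ) × ℝ) [⋀^Fin (p + q + 1)]→L[ℝ] ℝ :=
  schoutenFlat P Q y +
    (p : ℝ) • castDegree (Nat.add_right_comm p 1 q) (wedge (P y) (contract κ (Q y))) +
    ((-1 : ℝ) ^ (p + 1) * (q : ℝ)) • wedge (contract κ (P y)) (Q y)

/-- The bracket `[P, Q]^{(0,1)}` of sections of `⋀(TM × ℝ)`, computed at `x` in the chart centred
at `x`. -/
def schouten01 {p q : ℕ} (P : MultiSection V M (p + 1)) (Q : MultiSection V M (q + 1)) :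
    MultiSection V M (p + q + 1) := fun x =>
  (schoutenFlatMod (0, 1) (P.inChart x) (Q.inChart x)
    (extChartAt 𝓘(ℝ, V) x x)).compContinuousLinearMap (dualProd (chartDeriv x x).inverse)

/-! ### Twisted Jacobi structures -/

/-- A twisted Jacobi structure `((Λ, E), ω)` on `M`: smooth fields with
`1/2 [(Λ, E), (Λ, E)]^{(0,1)} = (Λ, E)^#(dω, ω)`. -/
structure IsTwistedJacobi (Λ : BivectorField V M) (E : VField V M) (ω : Form V M 2) : Prop where
  smooth_jacobiSection : (jacobiSection Λ E).IsSmooth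
  smooth_form : ω.IsSmooth
  schouten_eq : ∀ (x : M) (a : Fin 3 → (TangentSpace 𝓘(ℝ, V) x →L[ℝ] ℝ) × ℝ),
    (1 / 2 : ℝ) * schouten01 (jacobiSection Λ E) (jacobiSection Λ E) x a =
      jacobiSharpExt (Λ x) (E x) (pair (ω.d x) (ω x)) a

/-- The anchor `(α, f) ↦ Λ^# α + f E` of the Lie algebroid `T*M × ℝ`. -/
def anchor (Λ : BivectorField V M) (E : VField V M) (x : M) :
    ((TangentSpace 𝓘(ℝ, V) x →L[ℝ] ℝ) × ℝ) →ₗ[ℝ] TangentSpace 𝓘(ℝ, V) x :=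
  LinearMap.fst ℝ _ ℝ ∘ₗ jacobiSharp (Λ x) (E x)

/-- The characteristic distribution, the image of the anchor; it consists of the tangent spaces of
the characteristic leaves. -/
def characteristicDistribution (Λ : BivectorField V M) (E : VField V M) (x : M) :
    Submodule ℝ (TangentSpace 𝓘(ℝ, V) x) :=
  LinearMap.range (anchor Λ E x)

/-- Transitivity: the characteristic leaf through every point has the dimension of `M`. -/
def IsTransitive (Λ : BivectorField V M) (E : VField V M) : Prop :=
  ∀ x : M, Module.finrank ℝ (characteristicDistribution Λ E x) = Module.finrank ℝ V

/-- A twisted locally conformal symplectic structure `(ϑ, Θ, ω)` on `M`. -/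
structure IsTwistedLCS (ϑ : CovectorField V M) (Θ ω : Form V M 2) : Prop where
  even_dim : Even (Module.finrank ℝ V)
  smooth_covector : ϑ.toForm.IsSmooth
  smooth_two_form : Θ.IsSmooth
  smooth_twist : ω.IsSmooth
  nondegenerate : ∀ (x : M) (u : TangentSpace 𝓘(ℝ, V) x), (∀ v, Θ x ![u, v] = 0) → u = 0
  closed : ∀ x : M, ϑ.toForm.d x = 0
  d_eq : ∀ x : M, Form.d (Θ - ω) x +
    castDegree (Nat.add_comm 1 2) (wedge (ϑ.toForm x) ((Θ - ω) x)) = 0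

/-- `(Λ, E)` is the pair defined by the twisted locally conformal symplectic structure
`(ϑ, Θ, ω)`: `i(E)Θ = -ϑ` and `i(Λ^# α)Θ = -α` for all `α`. -/
structure IsInducedByLCS (Λ : BivectorField V M) (E : VField V M) (ϑ : CovectorField V M)
    (Θ : Form V M 2) : Prop where
  contract_E : ∀ (x : M) (v : TangentSpace 𝓘(ℝ, V) x), Θ x ![E x, v] = - ϑ x v
  contract_sharp : ∀ (x : M) (α : TangentSpace 𝓘(ℝ, V) x →L[ℝ] ℝ) (v : TangentSpace 𝓘(ℝ, V) x),
    Θ x ![sharp (Λ x) α, v] = - α v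

/-- A twisted contact structure `(ϑ, ω)` on a manifold `M` of dimension `2n + 1`:
`ϑ ∧ (dϑ + ω)^n` vanishes nowhere. -/
structure IsTwistedContact (n : ℕ) (ϑ : CovectorField V M) (ω : Form V M 2) : Prop where
  dim_eq : Module.finrank ℝ V = 2 * n + 1
  smooth_covector : ϑ.toForm.IsSmooth
  smooth_twist : ω.IsSmooth
  wedge_ne_zero : ∀ x : M, wedge (ϑ.toForm x) (wedgePow (ϑ.toForm.d x + ω x) n) ≠ 0

/-- `(Λ, E)` is the pair defined by the twisted contact structure `(ϑ, ω)`: with `Θ = dϑ + ω`,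
`i(E)ϑ = 1`, `i(E)Θ = 0`, `Λ^# ϑ = 0` and `i(Λ^# α)Θ = -(α - α(E) ϑ)` for all `α`. -/
structure IsInducedByContact (Λ : BivectorField V M) (E : VField V M) (ϑ : CovectorField V M)
    (ω : Form V M 2) : Prop where
  apply_E : ∀ x : M, ϑ x (E x) = 1
  contract_E : ∀ (x : M) (v : TangentSpace 𝓘(ℝ, V) x), (ϑ.toForm.d x + ω x) ![E x, v] = 0
  sharp_eq_zero : ∀ x : M, sharp (Λ x) (ϑ x) = 0
  contract_sharp : ∀ (x : M) (α : TangentSpace 𝓘(ℝ, V) x →L[ℝ] ℝ) (v : TangentSpace 𝓘(ℝ, V) x),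
    (ϑ.toForm.d x + ω x) ![sharp (Λ x) α, v] = -(α v - α (E x) * ϑ x v)

end Manifold

end TwistedJacobi

end

/-! Regard `P = (Λ, E)` as a 2-form on the fibres of `T*M × ℝ`, of dimension `dim M + 1`, and write
`S = (Λ, E)^#`, so that `P(a, b) = ⟨b, S a⟩`. Transitivity says that the first component of `S` is
onto. The forms sought come from linear algebra at each point, because a skew form on an
odd-dimensional space has a radical.

If `dim M` is even, `P` itself has a radical. Transitivity forces its `ℝ`-component to be nonzero,
so it is spanned by some `(ϑ, -1)`. This means `Λ^# ϑ = E`; hence `Λ^#` is invertible, and `Θ` is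
minus its inverse. If `dim M` is odd, `Λ` has a radical, and transitivity allows the normalisation
`ϑ(E) = 1`. Then `S` is invertible and `S(ϑ, 0) = (0, -1)`.

These equations determine `ϑ` and `Θ` as values of inverses of smooth families of linear maps, so
the pointwise choices are automatically smooth.

The differential identities come from evaluating the structure equation on suitable arguments in a
chart (`TwistedJacobiEqAt.expand`). On `(ϑ, -1)` the right side vanishes and `dϑ = 0` remains. On
triples `(α, 0)` the equation becomes `dΘ + ϑ ∧ Θ = dω + ϑ ∧ ω`, since `P` corresponds to `Θ` under
`Λ^#`. In the odd case, `(ϑ, 0)` gives `(dϑ + ω)(S b, S c) = P(b, c)` whenever `b` and `c`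
annihilate `E`. Every tangent vector is the anchor of such an element, and all the contact
identities follow. Finally `Θ = dϑ + ω` is non-degenerate on `ker ϑ`, and a symplectic basis
argument (`exists_wedgePow_ne_zero`) shows that `ϑ ∧ Θ^n` does not vanish. -/

namespace TwistedJacobi

/-! ### Wedge products and contraction. -/

section ExteriorAlgebra

/-- Expansion of a signed sum over permutations of a tuple along the position of its first entry. -/
theorem sum_perm_cons {U : Type*} {k : ℕ} (m : (Fin (k + 1) → U) → ℝ) (u : U) (w : Fin k → U) :
    ∑ σ : Equiv.Perm (Fin (k + 1)), Equiv.Perm.sign σ • m (fun i => Matrix.vecCons u w (σ i)) =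
      ∑ j : Fin (k + 1), (-1 : ℝ) ^ (j : ℕ) *
        ∑ τ : Equiv.Perm (Fin k), Equiv.Perm.sign τ • m (j.insertNth u (fun i => w (τ i))) := by
  -- A permutation is coded by the position `j` that it sends to `0` and by its action `τ` on the
  -- rest. The cycle moving `j` to `0` has sign `(-1)^j`.
  let F : Fin (k + 1) × Equiv.Perm (Fin k) → Equiv.Perm (Fin (k + 1)) :=
    fun x => Equiv.Perm.decomposeFin.symm (0, x.2) * x.1.cycleRange
  have hF0 : ∀ x, F x x.1 = 0 := fun x => by simp [F]
  have hinj : Function.Injective F := by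
    rintro ⟨i, s⟩ ⟨j, t⟩ h
    have hij : i = j := (F (i, s)).injective <| by
      rw [hF0 (i, s), h, hF0 (j, t)]
    subst hij
    have := Equiv.Perm.decomposeFin.symm.injective (mul_right_cancel h)
    simpa using this
  have hbij : Function.Bijective F := by
    rw [Fintype.bijective_iff_injective_and_card]
    exact ⟨hinj, by simp [Fintype.card_perm, Nat.factorial_succ]⟩
  rw [← (Equiv.ofBijective F hbij).sum_comp, Fintype.sum_prod_type]
  refine Finset.sum_congr rfl fun j _ => ?_
  rw [Finset.mul_sum]
  refine Finset.sum_congr rfl fun τ _ => ?_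
  have h1 : (fun i => Matrix.vecCons u w (F (j, τ) i)) = j.insertNth u (fun i => w (τ i)) := by
    rw [← Fin.cons_comp_cycleRange]
    funext i
    simp only [F, Equiv.Perm.mul_apply, Function.comp]
    refine Fin.cases ?_ (fun l => ?_) (j.cycleRange i)
    · simp
    · simp [Matrix.vecCons]
  rw [Equiv.ofBijective_apply, h1]
  simp [F, Equiv.Perm.decomposeFin.symm_sign, Units.smul_def, mul_assoc, mul_comm]

variable {U : Type*} [AddCommGroup U] [Module ℝ U] [TopologicalSpace U]

theorem castDegree_apply {m n : ℕ} (h : m = n) (a : U [⋀^Fin m]→L[ℝ] ℝ) (v : Fin n → U) :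
    castDegree h a v = a (fun i => v (Fin.cast h i)) := by
  subst h; rfl

theorem contract_apply {k : ℕ} (u : U) (a : U [⋀^Fin (k + 1)]→L[ℝ] ℝ) (v : Fin k → U) :
    contract u a v = a (Matrix.vecCons u v) := rfl

theorem oneForm_apply (α : U →L[ℝ] ℝ) (v : Fin 1 → U) : oneForm α v = α (v 0) := rfl

theorem wedge_apply {p q : ℕ} (a : U [⋀^Fin p]→L[ℝ] ℝ) (b : U [⋀^Fin q]→L[ℝ] ℝ)
    (v : Fin (p + q) → U) :
    wedge a b v = ((p.factorial : ℝ) * (q.factorial : ℝ))⁻¹ *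
      ∑ σ : Equiv.Perm (Fin (p + q)), Equiv.Perm.sign σ •
        (a (fun i => v (σ (Fin.castAdd q i))) * b (fun j => v (σ (Fin.natAdd p j)))) := by
  simp only [wedge, ContinuousAlternatingMap.smul_apply,
    ContinuousMultilinearMap.alternatization_apply_apply, smul_eq_mul]
  rfl

/-- The factors only ever see entries of `v`, so their values off `W` do not matter. Here `W` will
be an orthogonal complement, on which contractions simplify. -/
theorem wedge_congr_of_mem {p q : ℕ} {a a' : U [⋀^Fin p]→L[ℝ] ℝ} {b b' : U [⋀^Fin q]→L[ℝ] ℝ}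
    (W : Set U) (ha : ∀ v, (∀ i, v i ∈ W) → a v = a' v) (hb : ∀ v, (∀ i, v i ∈ W) → b v = b' v)
    (v : Fin (p + q) → U) (hv : ∀ i, v i ∈ W) : wedge a b v = wedge a' b' v := by
  rw [wedge_apply, wedge_apply]
  congr 1
  refine Finset.sum_congr rfl fun σ _ => ?_
  rw [ha _ fun i => hv _, hb _ fun i => hv _]

theorem wedge_eq_zero_of_right {p q : ℕ} (a : U [⋀^Fin p]→L[ℝ] ℝ) {b : U [⋀^Fin q]→L[ℝ] ℝ}
    (W : Set U) (hb : ∀ v, (∀ i, v i ∈ W) → b v = 0)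
    (v : Fin (p + q) → U) (hv : ∀ i, v i ∈ W) : wedge a b v = 0 := by
  rw [wedge_apply, Finset.sum_eq_zero fun σ _ => ?_, mul_zero]
  rw [hb _ fun i => hv _, mul_zero, smul_zero]

theorem sum_perm_sign_smul {k : ℕ} (a : U [⋀^Fin k]→L[ℝ] ℝ) (v : Fin k → U) :
    ∑ σ : Equiv.Perm (Fin k), Equiv.Perm.sign σ • a (fun i => v (σ i)) =
      (k.factorial : ℝ) * a v := by
  have h : ∀ σ : Equiv.Perm (Fin k), Equiv.Perm.sign σ • a (fun i => v (σ i)) = a v := fun σ => by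
    have := a.toAlternatingMap.map_perm v σ
    change a (fun i => v (σ i)) = _ at this
    rw [this, smul_smul, Int.units_mul_self, one_smul]
    rfl
  simp only [h, Finset.sum_const, Finset.card_univ, Fintype.card_perm, Fintype.card_fin,
    nsmul_eq_mul]

theorem wedge_degree_zero_right {p : ℕ} (a : U [⋀^Fin p]→L[ℝ] ℝ) (b : U [⋀^Fin 0]→L[ℝ] ℝ)
    (v : Fin p → U) : wedge a b v = a v * b ![] := by
  have h := wedge_apply a b v
  have e : ∀ w : Fin 0 → U, b w = b ![] := fun w => congrArg b (Subsingleton.elim _ _)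
  simp only [e] at h
  rw [h]
  change _ * ∑ σ : Equiv.Perm (Fin p), Equiv.Perm.sign σ • (a (fun i => v (σ i)) * b ![]) = _
  simp only [← smul_mul_assoc]
  rw [← Finset.sum_mul, sum_perm_sign_smul]
  have : (p.factorial : ℝ) ≠ 0 := by positivity
  simp; field_simp

theorem wedge_degree_zero_left {q : ℕ} (a : U [⋀^Fin 0]→L[ℝ] ℝ) (b : U [⋀^Fin q]→L[ℝ] ℝ)
    (v : Fin (0 + q) → U) :
    wedge a b v = a ![] * b (fun i => v (Fin.cast (Nat.zero_add q).symm i)) := by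
  have h := wedge_apply a b v
  have e : ∀ w : Fin 0 → U, a w = a ![] := fun w => congrArg a (Subsingleton.elim _ _)
  simp only [e] at h
  -- `0 + q` does not reduce to `q`, so the sum is reindexed over permutations of `Fin q`.
  rw [h, ← (Equiv.permCongr (finCongr (Nat.zero_add q).symm)).sum_comp
    (fun σ : Equiv.Perm (Fin (0 + q)) => Equiv.Perm.sign σ •
      (a ![] * b (fun j => v (σ (Fin.natAdd 0 j)))))]
  have := sum_perm_sign_smul b (fun i => v (Fin.cast (Nat.zero_add q).symm i))
  have hq : (q.factorial : ℝ) ≠ 0 := by positivity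
  rw [eq_comm, ← eq_inv_mul_iff_mul_eq₀ hq] at this
  rw [this, mul_left_comm (a ![]), Finset.mul_sum, Nat.factorial_zero, Nat.cast_one, one_mul]
  rw [Finset.mul_sum, Finset.mul_sum]
  refine Finset.sum_congr rfl fun σ _ => ?_
  refine congrArg _ ?_
  rw [mul_smul_comm, Equiv.Perm.sign_permCongr]
  congr 3
  funext j
  congr 1
  simp [Equiv.permCongr_apply]

theorem map_insertNth {k : ℕ} (a : U [⋀^Fin (k + 1)]→L[ℝ] ℝ) (i : Fin (k + 1)) (u : U)
    (v : Fin k → U) : a (i.insertNth u v) = (-1) ^ (i : ℕ) * a (Matrix.vecCons u v) := by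
  have := a.toAlternatingMap.map_insertNth i u v
  rcases Nat.even_or_odd (i : ℕ) with h | h <;> simpa [h.neg_one_pow] using this

/-- This and the next three lemmas describe the two blocks of a tuple after an insertion: the block
receiving `u` becomes an insertion, the other one is only reindexed. -/
theorem insertNth_castAdd_castAdd {X : Type*} {p q : ℕ} (i l : Fin (p + 1)) (u : X)
    (w : Fin (p + 1 + q) → X) :
    (Fin.insertNth (α := fun _ : Fin (p + 1 + q + 1) => X) (Fin.castAdd (q + 1) i) u w)
      (Fin.castAdd (q + 1) l) =
    Fin.insertNth (α := fun _ => X) i u (fun r : Fin p => w (Fin.castLE (by omega) r)) l := by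
  refine Fin.succAboveCases i ?_ (fun l' => ?_) l
  · exact (Fin.insertNth_apply_same (α := fun _ : Fin (p + 1 + q + 1) => X) _ _ _).trans
      (Fin.insertNth_apply_same (α := fun _ => X) _ _ _).symm
  · have : Fin.castAdd (q + 1) (i.succAbove l') =
        Fin.succAbove (n := p + 1 + q) (Fin.castAdd (q + 1) i) (Fin.castLE (by omega) l') := by
      ext
      simp only [Fin.succAbove, Fin.lt_def, Fin.val_castAdd, Fin.val_castSucc, Fin.val_castLE]
      split <;> simp
    rw [this]
    refine (Fin.insertNth_apply_succAbove (α := fun _ : Fin (p + 1 + q + 1) => X) _ _ _ _).trans ?_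
    rw [Fin.insertNth_apply_succAbove (α := fun _ => X)]

theorem insertNth_castAdd_natAdd {X : Type*} {p q : ℕ} (i : Fin (p + 1)) (l : Fin (q + 1)) (u : X)
    (w : Fin (p + 1 + q) → X) :
    (Fin.insertNth (α := fun _ : Fin (p + 1 + q + 1) => X) (Fin.castAdd (q + 1) i) u w)
      (Fin.natAdd (p + 1) l) = w (Fin.cast (by omega) (Fin.natAdd p l)) := by
  have : Fin.natAdd (p + 1) l = Fin.succAbove (n := p + 1 + q) (Fin.castAdd (q + 1) i)
      (Fin.cast (by omega) (Fin.natAdd p l)) := by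
    ext
    have := i.2
    simp only [Fin.succAbove, Fin.lt_def, Fin.val_castAdd, Fin.val_castSucc, Fin.val_cast,
      Fin.val_natAdd]
    split
    · omega
    · simp; omega
  rw [this]
  exact Fin.insertNth_apply_succAbove (α := fun _ : Fin (p + 1 + q + 1) => X) _ _ _ _

theorem insertNth_natAdd_castAdd {X : Type*} {p q : ℕ} (i : Fin (q + 1)) (l : Fin (p + 1)) (u : X)
    (w : Fin (p + 1 + q) → X) :
    (Fin.insertNth (α := fun _ : Fin (p + 1 + q + 1) => X) (Fin.natAdd (p + 1) i) u w)
      (Fin.castAdd (q + 1) l) = w (Fin.castAdd q l) := by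
  have : Fin.castAdd (q + 1) l = Fin.succAbove (n := p + 1 + q) (Fin.natAdd (p + 1) i)
      (Fin.castAdd q l) := by
    ext
    have := l.2
    simp only [Fin.succAbove, Fin.lt_def, Fin.val_castAdd, Fin.val_castSucc,
      Fin.val_natAdd]
    split
    · simp
    · omega
  rw [this]
  exact Fin.insertNth_apply_succAbove (α := fun _ : Fin (p + 1 + q + 1) => X) _ _ _ _

theorem insertNth_natAdd_natAdd {X : Type*} {p q : ℕ} (i l : Fin (q + 1)) (u : X)
    (w : Fin (p + 1 + q) → X) :
    (Fin.insertNth (α := fun _ : Fin (p + 1 + q + 1) => X) (Fin.natAdd (p + 1) i) u w)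
      (Fin.natAdd (p + 1) l) =
    Fin.insertNth (α := fun _ => X) i u (fun r : Fin q => w (Fin.natAdd (p + 1) r)) l := by
  refine Fin.succAboveCases i ?_ (fun l' => ?_) l
  · exact (Fin.insertNth_apply_same (α := fun _ : Fin (p + 1 + q + 1) => X) _ _ _).trans
      (Fin.insertNth_apply_same (α := fun _ => X) _ _ _).symm
  · have : Fin.natAdd (p + 1) (i.succAbove l') =
        Fin.succAbove (n := p + 1 + q) (Fin.natAdd (p + 1) i) (Fin.natAdd (p + 1) l') := by
      ext
      simp only [Fin.succAbove, Fin.lt_def, Fin.val_natAdd, Fin.val_castSucc]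
      split <;> split <;> simp <;> omega
    rw [this]
    refine (Fin.insertNth_apply_succAbove (α := fun _ : Fin (p + 1 + q + 1) => X) _ _ _ _).trans ?_
    rw [Fin.insertNth_apply_succAbove (α := fun _ => X)]

/-- Contraction is an antiderivation of the wedge product. -/
theorem wedge_vecCons {p q : ℕ} (a : U [⋀^Fin (p + 1)]→L[ℝ] ℝ) (b : U [⋀^Fin (q + 1)]→L[ℝ] ℝ)
    (u : U) (w : Fin (p + 1 + q) → U) :
    wedge a b (Matrix.vecCons u w : Fin (p + 1 + q + 1) → U) =
      wedge (contract u a) b (fun i => w (Fin.cast (by omega) i)) +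
        (-1) ^ (p + 1) * wedge a (contract u b) w := by
  have h := wedge_apply a b (Matrix.vecCons u w : Fin (p + 1 + q + 1) → U)
  -- Sort the permutations by the position of `u`: positions in the first block produce the
  -- contraction of `a`, those in the second the contraction of `b`.
  have h2 := sum_perm_cons (k := p + 1 + q) (fun v => a (fun i => v (Fin.castAdd (q + 1) i)) *
    b (fun j => v (Fin.natAdd (p + 1) j))) u w
  rw [h]
  refine (congrArg _ (h2.trans (Fin.sum_univ_add (a := p + 1) (b := q + 1) _))).trans ?_
  simp only [insertNth_castAdd_castAdd, insertNth_castAdd_natAdd, insertNth_natAdd_castAdd,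
    insertNth_natAdd_natAdd]
  have hl : ∀ (i : Fin (p + 1)) (τ : Equiv.Perm (Fin (p + 1 + q))),
      a (fun l => Fin.insertNth (α := fun _ => U) i u
        (fun r : Fin p => w (τ (Fin.castLE (by omega) r)))
        l) = (-1) ^ (i : ℕ) * contract u a (fun r => w (τ (Fin.castLE (by omega) r))) :=
    fun i τ => map_insertNth a i u _
  have hr : ∀ (i : Fin (q + 1)) (τ : Equiv.Perm (Fin (p + 1 + q))),
      b (fun l => Fin.insertNth (α := fun _ => U) i u
        (fun r : Fin q => w (τ (Fin.natAdd (p + 1) r))) l) =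
        (-1) ^ (i : ℕ) * contract u b (fun r => w (τ (Fin.natAdd (p + 1) r))) :=
    fun i τ => map_insertNth b i u _
  simp only [hl, hr]
  rw [wedge_apply, wedge_apply, ← (Equiv.permCongr (finCongr
    (show p + 1 + q = p + (q + 1) by omega))).sum_comp]
  -- The sign of the position cancels the sign of moving `u` to the front of its block. All
  -- positions in a block then contribute equally, and their number turns `(p + 1)!` into `p!`,
  -- respectively `(q + 1)!` into `q!`.
  have hsq : ∀ n : ℕ, (-1 : ℝ) ^ n * (-1) ^ n = 1 := fun n => by
    rw [← mul_pow]; simp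
  have e1 : ∀ (i : Fin (p + 1)) (x y : ℝ) (s : ℤˣ),
      (-1 : ℝ) ^ (i : ℕ) * (s • ((-1) ^ (i : ℕ) * x * y))
      = s • (x * y) := fun i x y s => by
    rw [mul_smul_comm]
    congr 1
    linear_combination x * y * hsq i
  have e2 : ∀ (i : Fin (q + 1)) (x y : ℝ) (s : ℤˣ),
      (-1 : ℝ) ^ (p + 1 + (i : ℕ)) * (s • (x * ((-1) ^ (i : ℕ) * y)))
      = (-1) ^ (p + 1) * s • (x * y) := fun i x y s => by
    rw [mul_smul_comm, mul_smul_comm, pow_add]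
    congr 1
    linear_combination (-1) ^ (p + 1) * x * y * hsq i
  simp only [Fin.val_castAdd, Fin.val_natAdd, Finset.mul_sum, e1, e2]
  simp only [← Finset.mul_sum, Finset.sum_const, Finset.card_univ, Fintype.card_fin, nsmul_eq_mul,
    Equiv.Perm.sign_permCongr, Nat.factorial_succ, Nat.cast_mul]
  have hp : ((p + 1 : ℕ) : ℝ) ≠ 0 := by positivity
  have hq : ((q + 1 : ℕ) : ℝ) ≠ 0 := by positivity
  have hp' : (p.factorial : ℝ) ≠ 0 := by positivity
  have hq' : (q.factorial : ℝ) ≠ 0 := by positivity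
  rw [mul_add]
  refine congrArg₂ (· + ·) ?_ ?_
  · rw [← mul_assoc]
    exact congrArg₂ (· * ·) (by field_simp) rfl
  · generalize (∑ i : Equiv.Perm (Fin (p + 1 + q)), (_ : ℝ)) = S
    field_simp

end ExteriorAlgebra

/-! ### Low degrees, and non-vanishing of powers of a 2-form. -/

section ExteriorAlgebra

variable {U : Type*} [AddCommGroup U] [Module ℝ U] [TopologicalSpace U]

theorem two_self (B : U [⋀^Fin 2]→L[ℝ] ℝ) (a : U) : B ![a, a] = 0 :=
  B.map_eq_zero_of_eq ![a, a] (i := 0) (j := 1) rfl (by decide)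

theorem two_swap (B : U [⋀^Fin 2]→L[ℝ] ℝ) (a b : U) : B ![a, b] = -B ![b, a] := by
  have := two_self B (a + b)
  rw [two_add_left, two_add_right, two_add_right, two_self, two_self] at this
  linarith

/-- A `2`-form as a bilinear map. -/
def bilin (B : U [⋀^Fin 2]→L[ℝ] ℝ) : U →ₗ[ℝ] U →ₗ[ℝ] ℝ :=
  LinearMap.mk₂ ℝ (fun u v => B ![u, v]) (two_add_left B)
    (fun r a c => two_smul_left B r a c) (fun c a b => two_add_right B a b c)
    (fun r a c => two_smul_right B r c a)

/-- Peeling off the first vector with `wedge_vecCons` leaves a factor of degree zero; the formulas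
in degree three follow by the same recursion. -/
theorem wedge_one_one (a b : U [⋀^Fin 1]→L[ℝ] ℝ) (x y : U) :
    wedge a b ![x, y] = a ![x] * b ![y] - a ![y] * b ![x] := by
  have h := wedge_vecCons a b x ![y]
  have h1 := wedge_degree_zero_left (contract x a) b ![y]
  have h2 := wedge_degree_zero_right a (contract x b) ![y]
  have e : (fun i => (![y] : Fin 1 → U) (Fin.cast (Nat.zero_add 1).symm i)) = ![y] := by
    ext i; fin_cases i; rfl
  rw [e] at h1
  refine h.trans ?_
  refine (congrArg₂ (fun s t => s + (-1) ^ (0 + 1) * t) h1 h2).trans ?_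
  simp only [contract_apply]
  change a ![x] * b ![y] + _ * (a ![y] * b ![x]) = _
  ring

theorem wedge_one_two (a : U [⋀^Fin 1]→L[ℝ] ℝ) (b : U [⋀^Fin 2]→L[ℝ] ℝ) (x y z : U) :
    wedge a b (![x, y, z] : Fin 3 → U) =
      a ![x] * b ![y, z] - a ![y] * b ![x, z] + a ![z] * b ![x, y] := by
  have h := wedge_vecCons a b x ![y, z]
  have h1 := wedge_degree_zero_left (contract x a) b ![y, z]
  have h2 := wedge_one_one a (contract x b) y z
  have e : (fun i => (![y, z] : Fin 2 → U) (Fin.cast (Nat.zero_add 2).symm i)) = ![y, z] := by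
    ext i; fin_cases i <;> rfl
  rw [e] at h1
  refine h.trans ?_
  refine (congrArg₂ (fun s t => s + (-1) ^ (0 + 1) * t) h1 h2).trans ?_
  simp only [contract_apply]
  change a ![x] * b ![y, z] + _ * (a ![y] * b ![x, z] - a ![z] * b ![x, y]) = _
  ring

theorem wedge_two_one (a : U [⋀^Fin 2]→L[ℝ] ℝ) (b : U [⋀^Fin 1]→L[ℝ] ℝ) (x y z : U) :
    wedge a b (![x, y, z] : Fin 3 → U) =
      b ![x] * a ![y, z] - b ![y] * a ![x, z] + b ![z] * a ![x, y] := by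
  have h := wedge_vecCons a b x ![y, z]
  have h1 := wedge_one_one (contract x a) b y z
  have h2 := wedge_degree_zero_right a (contract x b) ![y, z]
  refine h.trans ?_
  refine (congrArg₂ (fun s t => s + (-1) ^ (1 + 1) * t) h1 h2).trans ?_
  simp only [contract_apply]
  change a ![x, y] * b ![z] - a ![x, z] * b ![y] + _ * (a ![y, z] * b ![x]) = _
  ring

theorem pair_two_apply (a : U [⋀^Fin 2]→L[ℝ] ℝ) (b : U [⋀^Fin 1]→L[ℝ] ℝ) (p q : U × ℝ) :
    pair a b ![p, q] = a ![p.1, q.1] + p.2 * b ![q.1] - q.2 * b ![p.1] := by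
  rw [pair, ContinuousAlternatingMap.add_apply, castDegree_apply]
  have h := wedge_one_one (oneForm (ContinuousLinearMap.snd ℝ U ℝ))
    (b.compContinuousLinearMap (ContinuousLinearMap.fst ℝ U ℝ)) p q
  have ha : a.compContinuousLinearMap (ContinuousLinearMap.fst ℝ U ℝ) ![p, q] = a ![p.1, q.1] :=
    congrArg a (by ext i; fin_cases i <;> rfl)
  refine (congrArg₂ (· + ·) ha h).trans ?_
  have e : ∀ r : U × ℝ, (b.compContinuousLinearMap (ContinuousLinearMap.fst ℝ U ℝ)) ![r] =
      b ![r.1] := fun r => congrArg b (by ext i; fin_cases i; rfl)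
  rw [e, e, oneForm_apply, oneForm_apply]
  change _ + (p.2 * _ - q.2 * _) = _
  ring

theorem pair_three_apply (a : U [⋀^Fin 3]→L[ℝ] ℝ) (b : U [⋀^Fin 2]→L[ℝ] ℝ) (p q r : U × ℝ) :
    pair a b ![p, q, r] =
      a ![p.1, q.1, r.1] + p.2 * b ![q.1, r.1] - q.2 * b ![p.1, r.1] + r.2 * b ![p.1, q.1] := by
  rw [pair, ContinuousAlternatingMap.add_apply, castDegree_apply]
  have h := wedge_one_two (oneForm (ContinuousLinearMap.snd ℝ U ℝ))
    (b.compContinuousLinearMap (ContinuousLinearMap.fst ℝ U ℝ)) p q r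
  have ha : a.compContinuousLinearMap (ContinuousLinearMap.fst ℝ U ℝ) ![p, q, r] =
      a ![p.1, q.1, r.1] := congrArg a (by ext i; fin_cases i <;> rfl)
  refine (congrArg₂ (· + ·) ha h).trans ?_
  have e : ∀ r s : U × ℝ, (b.compContinuousLinearMap (ContinuousLinearMap.fst ℝ U ℝ)) ![r, s] =
      b ![r.1, s.1] := fun r s => congrArg b (by ext i; fin_cases i <;> rfl)
  rw [e, e, e, oneForm_apply, oneForm_apply, oneForm_apply]
  change _ + (p.2 * _ - q.2 * _ + r.2 * _) = _
  ring

/-- The contraction of a power of `Θ` with two vectors, on the `Θ`-orthogonal of these vectors. -/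
theorem wedgePow_succ_vecCons (Θ : U [⋀^Fin 2]→L[ℝ] ℝ) {W : Set U} {e f : U}
    (he : ∀ w ∈ W, Θ ![e, w] = 0) (hf : ∀ w ∈ W, Θ ![f, w] = 0) (n : ℕ) (w : Fin (2 * n) → U)
    (hw : ∀ i, w i ∈ W) :
    wedgePow Θ (n + 1) (Matrix.vecCons e (Matrix.vecCons f w) : Fin (2 * n + 1 + 1) → U) =
      (n + 1) * Θ ![e, f] * wedgePow Θ n w := by
  have hone : ∀ v : Fin 1 → U, v = ![v 0] := fun v => by ext i; fin_cases i; rfl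
  have he' : ∀ v : Fin 1 → U, (∀ i, v i ∈ W) → contract e Θ v = 0 := fun v hv => by
    rw [hone v]; exact he _ (hv 0)
  have hf' : ∀ v : Fin 1 → U, (∀ i, v i ∈ W) → contract f Θ v = 0 := fun v hv => by
    rw [hone v]; exact hf _ (hv 0)
  induction n with
  | zero =>
    have hw0 : w = ![] := funext fun i => i.elim0
    subst hw0
    refine (wedge_degree_zero_left (wedgePow Θ 0) Θ _).trans ?_
    have : wedgePow Θ 0 ![] = 1 := rfl
    have e : (fun i => (![e, f] : Fin 2 → U) (Fin.cast (Nat.zero_add 2).symm i)) = ![e, f] := by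
      ext i; fin_cases i <;> rfl
    refine (congrArg₂ (· * ·) this (congrArg Θ e)).trans ?_
    rw [this]; simp
  | succ n ih =>
    set a : U [⋀^Fin (2 * n + 1 + 1)]→L[ℝ] ℝ := wedgePow Θ (n + 1) with ha
    -- Contracting `a ∧ Θ` with `e` and `f` gives four terms. The two in which `Θ` receives exactly
    -- one of them vanish on `W`; the others contribute `n + 1` and `1` times the same quantity.
    have h1 := wedge_vecCons (p := 2 * n + 1) (q := 1) a Θ e (Matrix.vecCons f w)
    have h2 := wedge_vecCons (p := 2 * n) (q := 1) (contract e a) Θ f w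
    have h3 := wedge_vecCons (p := 2 * n + 1) (q := 0) a (contract e Θ) f w
    have h4 : wedge (contract e a) (contract f Θ) w = 0 :=
      wedge_eq_zero_of_right _ W hf' w hw
    have h5 : wedge (contract f a) (contract e Θ) w = 0 :=
      wedge_eq_zero_of_right _ W he' w hw
    have h6 := wedge_degree_zero_right a (contract f (contract e Θ)) w
    have h7 : wedge (contract f (contract e a)) Θ w =
        wedge (((n + 1) * Θ ![e, f]) • wedgePow Θ n) Θ w := by
      refine wedge_congr_of_mem W (fun v hv => ?_) (fun _ _ => rfl) w hw
      exact ih v hv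
    have h8 : wedge (((n + 1) * Θ ![e, f]) • wedgePow Θ n) Θ w =
        ((n + 1) * Θ ![e, f]) * a w := by
      rw [wedge_apply, ha]
      refine Eq.trans ?_ (congrArg _ (wedge_apply (wedgePow Θ n) Θ w).symm)
      rw [mul_left_comm _ (_⁻¹), Finset.mul_sum _ _ ((n + 1) * Θ ![e, f])]
      refine congrArg _ (Finset.sum_congr rfl fun σ _ => ?_)
      rw [ContinuousAlternatingMap.smul_apply, smul_eq_mul, mul_smul_comm, mul_assoc]
    have h9 : contract f (contract e Θ) ![] = Θ ![e, f] := rfl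
    refine h1.trans ?_
    refine (congrArg₂ (fun s t => s + (-1) ^ (2 * n + 1 + 1) * t) h2 h3).trans ?_
    refine (congrArg₂ (fun s t => (s + (-1) ^ (2 * n + 1) * t) + (-1) ^ (2 * n + 1 + 1) * _)
      (h7.trans h8) h4).trans ?_
    refine (congrArg₂ (fun s t => _ + (-1) ^ (2 * n + 1 + 1) *
      (s + (-1) ^ (2 * n + 1 + 1) * t)) h5 h6).trans ?_
    rw [h9]
    have : Even (2 * n + 1 + 1) := ⟨n + 1, by ring⟩
    rw [this.neg_one_pow]
    push_cast
    ring

/-- The top power of a `2`-form that is non-degenerate on a subspace does not vanish there. -/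
theorem exists_wedgePow_ne_zero [FiniteDimensional ℝ U] (Θ : U [⋀^Fin 2]→L[ℝ] ℝ) (n : ℕ)
    (W : Submodule ℝ U) (hW : Module.finrank ℝ W = 2 * n)
    (hΘ : ∀ u ∈ W, (∀ v ∈ W, Θ ![u, v] = 0) → u = 0) :
    ∃ w : Fin (2 * n) → U, (∀ i, w i ∈ W) ∧ wedgePow Θ n w ≠ 0 := by
  induction n generalizing W with
  | zero => exact ⟨![], fun i => i.elim0, by simp [wedgePow]⟩
  | succ n ih =>
    have hpos : 0 < Module.finrank ℝ W := by omega
    have : Nontrivial W := Module.nontrivial_of_finrank_pos hpos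
    obtain ⟨⟨e, heW⟩, he0⟩ := exists_ne (0 : W)
    have he0 : e ≠ 0 := fun h => he0 (Subtype.ext h)
    obtain ⟨f, hfW, hef⟩ : ∃ f ∈ W, Θ ![e, f] ≠ 0 := by
      by_contra! h
      exact he0 (hΘ e heW h)
    -- Its kernel is the `Θ`-orthogonal of the hyperbolic plane spanned by `e` and `f`, of dimension
    -- two less.
    let φ : W →ₗ[ℝ] ℝ × ℝ := ((bilin Θ e).prod (bilin Θ f)).comp W.subtype
    have hφ : LinearMap.range φ = ⊤ := by
      rw [eq_top_iff]
      rintro ⟨s, t⟩ -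
      refine ⟨⟨(s / Θ ![e, f]) • f + (-(t / Θ ![e, f])) • e,
        W.add_mem (W.smul_mem _ hfW) (W.smul_mem _ heW)⟩, ?_⟩
      refine Prod.ext ?_ ?_
      · change Θ ![e, (s / Θ ![e, f]) • f + (-(t / Θ ![e, f])) • e] = s
        rw [two_add_right, two_smul_right, two_smul_right, two_self]
        field_simp; ring
      · change Θ ![f, (s / Θ ![e, f]) • f + (-(t / Θ ![e, f])) • e] = t
        rw [two_add_right, two_smul_right, two_smul_right, two_self, two_swap Θ f e]
        field_simp; ring
    have hK : Module.finrank ℝ (LinearMap.ker φ) = 2 * n := by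
      have := φ.finrank_range_add_finrank_ker
      rw [hφ, finrank_top, Module.finrank_prod, Module.finrank_self] at this
      omega
    let W' : Submodule ℝ U := (LinearMap.ker φ).map W.subtype
    have hW' : Module.finrank ℝ W' = 2 * n := by
      rw [← hK]
      exact (Submodule.equivMapOfInjective _ W.injective_subtype _).finrank_eq.symm
    have hmem : ∀ u, u ∈ W' ↔ u ∈ W ∧ Θ ![e, u] = 0 ∧ Θ ![f, u] = 0 := fun u => by
      constructor
      · rintro ⟨⟨v, hv⟩, hk, rfl⟩
        have := (Prod.ext_iff.1 (LinearMap.mem_ker.1 hk))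
        exact ⟨hv, this.1, this.2⟩
      · rintro ⟨hv, h1, h2⟩
        exact ⟨⟨u, hv⟩, LinearMap.mem_ker.2 (Prod.ext h1 h2), rfl⟩
    obtain ⟨w, hwW, hw⟩ := ih W' hW' fun u hu hperp => by
      obtain ⟨huW, hue, huf⟩ := (hmem u).1 hu
      refine hΘ u huW fun v hv => ?_
      -- Coefficients of the projection of `v` along the plane to its orthogonal. The correction
      -- does not affect `Θ(u, v)`, as `u` is orthogonal to `e` and `f`.
      set s := Θ ![f, v] / Θ ![e, f]
      set t := Θ ![e, v] / Θ ![e, f]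
      have hv' : v + s • e + (-t) • f ∈ W' := by
        refine (hmem _).2 ⟨W.add_mem (W.add_mem hv (W.smul_mem _ heW)) (W.smul_mem _ hfW), ?_, ?_⟩
        · simp only [two_add_right, two_smul_right, two_self, s, t]
          field_simp; ring
        · simp only [two_add_right, two_smul_right, two_self, two_swap Θ f e, s, t]
          field_simp; ring
      have := hperp _ hv'
      simp only [two_add_right, two_smul_right, two_swap Θ u e, two_swap Θ u f, hue, huf] at this
      simpa using this
    refine ⟨(Matrix.vecCons e (Matrix.vecCons f w) : Fin (2 * n + 1 + 1) → U), ?_, ?_⟩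
    · intro i
      refine Fin.cases heW (fun i => ?_) i
      exact Fin.cases hfW (fun i => ((hmem _).1 (hwW i)).1) i
    · have := wedgePow_succ_vecCons Θ (W := W') (e := e) (f := f)
        (fun w hw => ((hmem w).1 hw).2.1) (fun w hw => ((hmem w).1 hw).2.2) n w hwW
      refine fun h => ?_
      rw [h] at this
      have hn : (n + 1 : ℝ) ≠ 0 := by positivity
      exact mul_ne_zero (mul_ne_zero hn hef) hw this.symm

/-- `E` is a complement of `ker ϑ` lying in the radical of `Θ`, so `Θ` is non-degenerate on `ker ϑ`.
On `E` followed by vectors of `ker ϑ`, the wedge reduces to the power of `Θ` on the latter. -/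
theorem wedge_oneForm_wedgePow_ne_zero [FiniteDimensional ℝ U] {ϑ : U →L[ℝ] ℝ}
    {Θ : U [⋀^Fin 2]→L[ℝ] ℝ} {E : U} {n : ℕ} (hdim : Module.finrank ℝ U = 2 * n + 1)
    (hE : ϑ E = 1) (hΘE : ∀ v, Θ ![E, v] = 0)
    (hΘ : ∀ u, ϑ u = 0 → (∀ v, Θ ![u, v] = 0) → u = 0) :
    wedge (oneForm ϑ) (wedgePow Θ n) ≠ 0 := by
  have hrange : LinearMap.range (ϑ : U →ₗ[ℝ] ℝ) = ⊤ := by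
    rw [eq_top_iff]
    rintro s -
    exact ⟨s • E, by simp [hE]⟩
  have hker : Module.finrank ℝ (LinearMap.ker (ϑ : U →ₗ[ℝ] ℝ)) = 2 * n := by
    have := (ϑ : U →ₗ[ℝ] ℝ).finrank_range_add_finrank_ker
    rw [hrange, finrank_top, Module.finrank_self] at this
    omega
  obtain ⟨w, hwW, hw⟩ := exists_wedgePow_ne_zero Θ n _ hker fun u hu hperp => by
    refine hΘ u hu fun v => ?_
    have hv : v + (-ϑ v) • E ∈ LinearMap.ker (ϑ : U →ₗ[ℝ] ℝ) := by simp [hE]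
    have := hperp _ hv
    rw [two_add_right, two_smul_right, two_swap Θ u E, hΘE] at this
    simpa using this
  intro h0
  -- For `n = 0` the power has degree zero and cannot be contracted with `E`, so the wedge is
  -- evaluated directly.
  cases n with
  | zero =>
    have := wedge_degree_zero_right (oneForm ϑ) (wedgePow Θ 0) ![E]
    rw [oneForm_apply] at this
    change _ = ϑ E * 1 at this
    rw [hE] at this
    have h1 := congrArg (fun a => a ![E]) h0
    exact one_ne_zero ((mul_one (1 : ℝ)).symm.trans (this.symm.trans h1))
  | succ n =>
    have hc : 0 + 1 + (2 * n + 1) = 2 * (n + 1) := by ring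
    have h1 := wedge_vecCons (p := 0) (q := 2 * n + 1) (oneForm ϑ) (wedgePow Θ (n + 1)) E
      (fun i => w (Fin.cast hc i))
    have h2 := wedge_degree_zero_left (contract E (oneForm ϑ)) (wedgePow Θ (n + 1))
      (fun i => w (Fin.cast (Nat.zero_add _) i))
    have h3 : wedge (oneForm ϑ) (contract E (wedgePow Θ (n + 1)))
        (fun i : Fin (0 + 1 + (2 * n + 1)) => w (Fin.cast hc i)) = 0 := by
      rw [wedge_apply, Finset.sum_eq_zero fun σ _ => ?_, mul_zero]
      have : ∀ i, ϑ (w i) = 0 := hwW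
      rw [oneForm_apply, this, zero_mul, smul_zero]
    have h4 := congrArg (fun a => a (Matrix.vecCons E fun i : Fin (0 + 1 + (2 * n + 1)) =>
      w (Fin.cast hc i) : Fin (0 + 1 + (2 * n + 1) + 1) → U)) h0
    rw [h3, mul_zero, add_zero] at h1
    have h5 := (h2.symm.trans h1.symm).trans h4
    have h6 : contract E (oneForm ϑ) ![] = 1 := hE
    rw [h6, one_mul] at h5
    exact hw h5

end ExteriorAlgebra

/-! ### Linear algebra of a transitive pair at a point. -/

section PointwiseAlgebra

/-- An alternating bilinear form on an odd-dimensional space is degenerate. -/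
theorem exists_ne_zero_forall_eq_zero_of_odd {D : Type*} [AddCommGroup D] [Module ℝ D]
    [FiniteDimensional ℝ D] (hD : Odd (Module.finrank ℝ D)) (B : D →ₗ[ℝ] D →ₗ[ℝ] ℝ)
    (hB : ∀ a b, B a b = -B b a) : ∃ a, a ≠ 0 ∧ ∀ b, B a b = 0 := by
  let b := Module.finBasis ℝ D
  let A : Matrix (Fin (Module.finrank ℝ D)) (Fin (Module.finrank ℝ D)) ℝ :=
    Matrix.of fun i j => B (b i) (b j)
  have hA : A.transpose = -A := by
    ext i j
    exact hB _ _
  -- A skew matrix of odd size satisfies `det A = det Aᵀ = -det A`.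
  have hdet : A.det = 0 := by
    have h := A.det_transpose
    rw [hA, Matrix.det_neg, Fintype.card_fin, hD.neg_one_pow] at h
    linarith
  obtain ⟨v, hv0, hv⟩ := Matrix.exists_mulVec_eq_zero_iff.2 hdet
  refine ⟨∑ j, v j • b j, fun h => hv0 ?_, fun c => ?_⟩
  · funext j
    exact Fintype.linearIndependent_iff.1 b.linearIndependent v h j
  · have : (B (∑ j, v j • b j)) = 0 := b.ext fun i => by
      have hi := congrFun hv i
      simp only [Matrix.mulVec, dotProduct, A, Matrix.of_apply, Pi.zero_apply] at hi
      rw [map_sum, LinearMap.sum_apply, LinearMap.zero_apply, ← neg_eq_zero,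
        ← Finset.sum_neg_distrib, ← hi]
      refine Finset.sum_congr rfl fun j _ => ?_
      rw [map_smul, LinearMap.smul_apply, smul_eq_mul, hB (b i) (b j)]
      ring
    rw [this, LinearMap.zero_apply]

variable {U : Type*} [AddCommGroup U] [Module ℝ U] [TopologicalSpace U]

theorem pair_oneForm_apply [ContinuousSMul ℝ U] (Λ : (U →L[ℝ] ℝ) [⋀^Fin 2]→L[ℝ] ℝ) (E : U)
    (a b : (U →L[ℝ] ℝ) × ℝ) :
    pair Λ (oneForm (evalAt E)) ![a, b] = Λ ![a.1, b.1] + a.2 * b.1 E - b.2 * a.1 E :=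
  pair_two_apply _ _ _ _

variable [IsTopologicalAddGroup U] [ContinuousSMul ℝ U] [T2Space U] [FiniteDimensional ℝ U]

theorem finrank_continuousDual : Module.finrank ℝ (U →L[ℝ] ℝ) = Module.finrank ℝ U :=
  (LinearMap.toContinuousLinearMap (𝕜 := ℝ) (E := U) (F' := ℝ)).finrank_eq.symm.trans
    Subspace.dual_finrank_eq

instance finiteDimensional_continuousDual : FiniteDimensional ℝ (U →L[ℝ] ℝ) :=
  Module.Finite.equiv (LinearMap.toContinuousLinearMap (𝕜 := ℝ) (E := U) (F' := ℝ))

theorem ext_continuousDual {u v : U} (h : ∀ β : U →L[ℝ] ℝ, β u = β v) : u = v := by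
  rw [← sub_eq_zero, ← Module.forall_dual_apply_eq_zero_iff ℝ]
  intro φ
  have := h (LinearMap.toContinuousLinearMap φ)
  simpa [sub_eq_zero] using this

variable (Λ : (U →L[ℝ] ℝ) [⋀^Fin 2]→L[ℝ] ℝ) (E : U)

theorem apply_sharp_swap (α β : U →L[ℝ] ℝ) : β (sharp Λ α) = -α (sharp Λ β) := by
  rw [apply_sharp, apply_sharp, two_swap]

theorem apply_sharp_self (α : U →L[ℝ] ℝ) : α (sharp Λ α) = 0 := by
  rw [apply_sharp, two_self]

theorem jacobiSharp_fst (a : (U →L[ℝ] ℝ) × ℝ) :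
    (jacobiSharp Λ E a).1 = sharp Λ a.1 + a.2 • E := rfl

theorem jacobiSharp_snd (a : (U →L[ℝ] ℝ) × ℝ) : (jacobiSharp Λ E a).2 = -a.1 E := rfl

/-- This identifies the radical of the 2-form `(Λ, E)` with the kernel of `(Λ, E)^#`. -/
theorem pair_oneForm_eq_jacobiSharp (a b : (U →L[ℝ] ℝ) × ℝ) :
    pair Λ (oneForm (evalAt E)) ![a, b] =
      b.1 (jacobiSharp Λ E a).1 + b.2 * (jacobiSharp Λ E a).2 := by
  rw [pair_oneForm_apply, jacobiSharp_fst, jacobiSharp_snd, map_add, map_smul, apply_sharp,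
    smul_eq_mul]
  ring

theorem sharp_compContinuousLinearMap {U' : Type*} [AddCommGroup U'] [Module ℝ U']
    [TopologicalSpace U'] [IsTopologicalAddGroup U'] [ContinuousSMul ℝ U'] [T2Space U']
    [FiniteDimensional ℝ U'] (T : U →L[ℝ] U') (α : U' →L[ℝ] ℝ) :
    sharp (Λ.compContinuousLinearMap (ContinuousLinearMap.precomp ℝ T)) α =
      T (sharp Λ (α.comp T)) := by
  refine ext_continuousDual fun β => ?_
  rw [apply_sharp]
  have := apply_sharp Λ (α.comp T) (β.comp T)
  refine Eq.trans ?_ this.symm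
  refine congrArg Λ ?_
  ext i; fin_cases i <;> rfl

/-- The anchor of `(Λ, E)` is surjective. -/
def AnchorSurjective : Prop := ∀ u : U, ∃ a : (U →L[ℝ] ℝ) × ℝ, (jacobiSharp Λ E a).1 = u

variable {Λ E}

/-- By skewness of `Λ`, such an `α` annihilates the image of the anchor. -/
theorem AnchorSurjective.eq_zero (h : AnchorSurjective Λ E) {α : U →L[ℝ] ℝ}
    (hα : sharp Λ α = 0) (hαE : α E = 0) : α = 0 := by
  ext u
  obtain ⟨a, rfl⟩ := h u
  rw [jacobiSharp_fst, map_add, map_smul, hαE, apply_sharp_swap, hα]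
  simp

/-- The 2-form `(Λ, E)` lives on a space of odd dimension, so it has a radical vector `k`. Its
scalar part is nonzero by `AnchorSurjective.eq_zero`, and rescaling makes it `-1`. -/
theorem AnchorSurjective.exists_sharp_eq (h : AnchorSurjective Λ E)
    (heven : Even (Module.finrank ℝ U)) :
    ∃ ϑ : U →L[ℝ] ℝ, sharp Λ ϑ = E := by
  have hodd : Odd (Module.finrank ℝ ((U →L[ℝ] ℝ) × ℝ)) := by
    rw [Module.finrank_prod, finrank_continuousDual, Module.finrank_self]
    exact heven.add_one
  obtain ⟨k, hk0, hk⟩ := exists_ne_zero_forall_eq_zero_of_odd hodd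
    (bilin (pair Λ (oneForm (evalAt E)))) (two_swap (pair Λ (oneForm (evalAt E))))
  have hk' : ∀ b : (U →L[ℝ] ℝ) × ℝ,
      b.1 (jacobiSharp Λ E k).1 + b.2 * (jacobiSharp Λ E k).2 = 0 := fun b => by
    rw [← pair_oneForm_eq_jacobiSharp]
    exact hk b
  have h1 : sharp Λ k.1 + k.2 • E = 0 := ext_continuousDual fun β => by
    have := hk' (β, 0)
    rw [zero_mul, add_zero, jacobiSharp_fst] at this
    rw [map_zero]
    exact this
  have h2 : k.1 E = 0 := by
    have := hk' (0, 1)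
    simpa [jacobiSharp_snd] using this
  have h3 : k.2 ≠ 0 := fun h3 => by
    rw [h3, zero_smul, add_zero] at h1
    exact hk0 (Prod.ext (h.eq_zero h1 h2) h3)
  refine ⟨-(k.2⁻¹) • k.1, ?_⟩
  rw [map_smul, eq_neg_of_add_eq_zero_left h1, smul_neg, neg_smul, neg_neg, smul_smul,
    inv_mul_cancel₀ h3, one_smul]

/-- Since `E = Λ^# ϑ`, a covector killed by `Λ^#` also annihilates `E`. -/
theorem AnchorSurjective.sharp_injective (h : AnchorSurjective Λ E)
    (heven : Even (Module.finrank ℝ U)) : Function.Injective (sharp Λ) := by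
  obtain ⟨ϑ, hϑ⟩ := h.exists_sharp_eq heven
  rw [← LinearMap.ker_eq_bot, LinearMap.ker_eq_bot']
  intro α hα
  refine h.eq_zero hα ?_
  rw [← hϑ, apply_sharp_swap, hα, map_zero, neg_zero]

theorem sharp_bijective (h : Function.Injective (sharp Λ)) : Function.Bijective (sharp Λ) :=
  ⟨h, (LinearMap.injective_iff_surjective_of_finrank_eq_finrank finrank_continuousDual).1 h⟩

/-- Here `Λ` itself is degenerate; a radical covector cannot annihilate `E`, so it can be
normalised. -/
theorem AnchorSurjective.exists_contactCovector (h : AnchorSurjective Λ E)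
    (hodd : Odd (Module.finrank ℝ U)) : ∃ ϑ : U →L[ℝ] ℝ, sharp Λ ϑ = 0 ∧ ϑ E = 1 := by
  rw [← finrank_continuousDual (U := U)] at hodd
  obtain ⟨k, hk0, hk⟩ := exists_ne_zero_forall_eq_zero_of_odd hodd (bilin Λ)
    (two_swap Λ)
  have h1 : sharp Λ k = 0 := ext_continuousDual fun β => by
    rw [apply_sharp, map_zero]
    exact hk β
  have h2 : k E ≠ 0 := fun h2 => hk0 (h.eq_zero h1 h2)
  exact ⟨(k E)⁻¹ • k, by rw [map_smul, h1, smul_zero], by simp [h2]⟩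

theorem AnchorSurjective.jacobiSharp_bijective (h : AnchorSurjective Λ E)
    {ϑ : U →L[ℝ] ℝ} (hϑ : sharp Λ ϑ = 0) (hϑE : ϑ E = 1) :
    Function.Bijective (jacobiSharp Λ E) := by
  have hinj : Function.Injective (jacobiSharp Λ E) := by
    rw [← LinearMap.ker_eq_bot, LinearMap.ker_eq_bot']
    intro a ha
    have h1 : sharp Λ a.1 + a.2 • E = 0 := congrArg Prod.fst ha
    have h2 : a.1 E = 0 := neg_eq_zero.1 (congrArg Prod.snd ha)
    -- `ϑ` vanishes on the image of `Λ^#`, so it reads off the coefficient of `E`.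
    have h3 : a.2 = 0 := by
      have := congrArg ϑ h1
      rw [map_add, map_smul, apply_sharp_swap, hϑ, hϑE] at this
      simpa using this
    rw [h3, zero_smul, add_zero] at h1
    exact Prod.ext (h.eq_zero h1 h2) h3
  refine ⟨hinj, (LinearMap.injective_iff_surjective_of_finrank_eq_finrank ?_).1 hinj⟩
  rw [Module.finrank_prod, Module.finrank_prod, finrank_continuousDual]

/-- An alternating bilinear form on a finite-dimensional space as a `2`-form. -/
def ofBilin (T : U →ₗ[ℝ] U →ₗ[ℝ] ℝ) (hT : ∀ u, T u u = 0) : U [⋀^Fin 2]→L[ℝ] ℝ where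
  toFun v := T (v 0) (v 1)
  map_update_add' := @fun inst v i x y => by
    obtain rfl := Subsingleton.elim inst (instDecidableEqFin 2)
    have h01 : (0 : Fin 2) ≠ 1 := by decide
    refine Fin.cases ?_ (fun i => ?_) i
    · simp only [Function.update_self, Function.update_of_ne h01.symm, map_add, LinearMap.add_apply]
    · obtain rfl := Subsingleton.elim i 0
      simp only [Fin.succ_zero_eq_one, Function.update_self, Function.update_of_ne h01, map_add]
  map_update_smul' := @fun inst v i c x => by
    obtain rfl := Subsingleton.elim inst (instDecidableEqFin 2)
    have h01 : (0 : Fin 2) ≠ 1 := by decide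
    refine Fin.cases ?_ (fun i => ?_) i
    · simp only [Function.update_self, Function.update_of_ne h01.symm]
      rw [map_smul]
      rfl
    · obtain rfl := Subsingleton.elim i 0
      change T (Function.update v 1 (c • x) 0) (Function.update v 1 (c • x) 1) =
        c • T (Function.update v 1 x 0) (Function.update v 1 x 1)
      rw [Function.update_self, Function.update_self, Function.update_of_ne h01,
        Function.update_of_ne h01, map_smul]
  map_eq_zero_of_eq' v i j h hij := by
    have h01 : v 0 = v 1 := by
      fin_cases i <;> fin_cases j <;> first | exact absurd rfl hij | exact h | exact h.symm
    change T (v 0) (v 1) = 0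
    rw [h01, hT]
  cont := by
    have h : ∀ u v : U, T u v = ∑ i, (Module.finBasis ℝ U).coord i u *
        T (Module.finBasis ℝ U i) v := fun u v => by
      conv_lhs => rw [← (Module.finBasis ℝ U).sum_repr u]
      rw [map_sum, LinearMap.sum_apply]
      simp
    refine (continuous_congr fun v : Fin 2 → U => h (v 0) (v 1)).2 ?_
    refine continuous_finsetSum _ fun i _ => Continuous.mul ?_ ?_
    · exact (LinearMap.continuous_of_finiteDimensional _).comp (continuous_apply 0)
    · exact (LinearMap.continuous_of_finiteDimensional _).comp (continuous_apply 1)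

/-- `Θ` is minus the inverse of `Λ^#`; it is alternating because `α(Λ^# α) = 0`. -/
theorem exists_two_form_of_sharp_injective (h : Function.Injective (sharp Λ)) :
    ∃ Θ : U [⋀^Fin 2]→L[ℝ] ℝ, ∀ α v, Θ ![sharp Λ α, v] = -α v := by
  let e := LinearEquiv.ofBijective (sharp Λ) (sharp_bijective h)
  let T : U →ₗ[ℝ] U →ₗ[ℝ] ℝ :=
    -((LinearMap.toContinuousLinearMap (𝕜 := ℝ) (E := U) (F' := ℝ)).symm.toLinearMap ∘ₗ
      e.symm.toLinearMap)
  have hT : ∀ α v, T (sharp Λ α) v = -α v := fun α v => by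
    change -(e.symm (e α)) v = _
    rw [e.symm_apply_apply]
  refine ⟨ofBilin T fun u => ?_, fun α v => hT α v⟩
  obtain ⟨α, rfl⟩ := (sharp_bijective h).2 u
  rw [hT, apply_sharp_self, neg_zero]

end PointwiseAlgebra

/-! ### Smoothness of the fields defined by inverting `Λ^#` or `(Λ, E)^#`. -/

section Smoothness

variable {X : Type*} [NormedAddCommGroup X] [NormedSpace ℝ X]
  {D : Type*} [NormedAddCommGroup D] [NormedSpace ℝ D] [FiniteDimensional ℝ D]
  {D' : Type*} [NormedAddCommGroup D'] [NormedSpace ℝ D']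
  {s : Set X} {n : WithTop ℕ∞}

/-- A family of alternating maps on a finite-dimensional space is smooth if all its values are. -/
theorem contDiffOn_alternating {k : ℕ} {f : X → D [⋀^Fin k]→L[ℝ] ℝ}
    (hf : ∀ v, ContDiffOn ℝ n (fun x => f x v) s) : ContDiffOn ℝ n f s := by
  let b := Module.finBasis ℝ D
  -- Evaluation on tuples of basis vectors is injective, and a linear left inverse is continuous
  -- since its domain is finite-dimensional.
  let J : (D [⋀^Fin k]→L[ℝ] ℝ) →ₗ[ℝ] ((Fin k → Fin (Module.finrank ℝ D)) → ℝ) :=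
    { toFun := fun a r => a fun i => b (r i)
      map_add' := fun _ _ => rfl
      map_smul' := fun _ _ => rfl }
  have hJ : Function.Injective J := fun a a' h => by
    have : a.toMultilinearMap = a'.toMultilinearMap :=
      Module.Basis.ext_multilinear (fun _ => b) fun r => congrFun h r
    ext v
    exact congrArg (fun m => m v) this
  obtain ⟨K, hK⟩ := J.exists_leftInverse_of_injective (LinearMap.ker_eq_bot.2 hJ)
  have hfK : f = fun x => LinearMap.toContinuousLinearMap K (J (f x)) := by
    funext x
    exact (LinearMap.congr_fun hK (f x)).symm
  rw [hfK]
  exact (LinearMap.toContinuousLinearMap K).contDiff.comp_contDiffOn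
    (contDiffOn_pi.2 fun r => hf _)

theorem contDiffOn_of_dual {f : X → D} (hf : ∀ β : D →L[ℝ] ℝ, ContDiffOn ℝ n (fun x => β (f x)) s) :
    ContDiffOn ℝ n f s := by
  have h : f = fun x => ∑ i, (Module.finBasis ℝ D).coord i (f x) • Module.finBasis ℝ D i := by
    funext x
    exact ((Module.finBasis ℝ D).sum_repr (f x)).symm
  rw [h]
  refine ContDiffOn.sum fun i _ => ContDiffOn.smul ?_ contDiffOn_const
  exact hf (LinearMap.toContinuousLinearMap ((Module.finBasis ℝ D).coord i))

theorem contDiffOn_inverse {f : X → D →L[ℝ] D'} (hf : ContDiffOn ℝ n f s)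
    (hbij : ∀ x ∈ s, Function.Bijective (f x)) :
    ContDiffOn ℝ n (fun x => (f x).inverse) s := fun x hx => by
  have := FiniteDimensional.complete ℝ D
  let e : D ≃L[ℝ] D' :=
    (LinearEquiv.ofBijective (f x : D →ₗ[ℝ] D') (hbij x hx)).toContinuousLinearEquiv
  have he : (e : D →L[ℝ] D') = f x := by ext; rfl
  have h := contDiffAt_map_inverse (n := n) e
  rw [he] at h
  exact h.comp_contDiffWithinAt x (hf x hx)

theorem inverse_apply_of_bijective {f : D →L[ℝ] D'} (hf : Function.Bijective f) {x : D} {y : D'}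
    (h : f x = y) : f.inverse y = x := by
  let e : D ≃L[ℝ] D' := (LinearEquiv.ofBijective (f : D →ₗ[ℝ] D') hf).toContinuousLinearEquiv
  have he : (e : D →L[ℝ] D') = f := by ext; rfl
  rw [← he, ContinuousLinearMap.inverse_equiv, ← h, ← he]
  exact e.symm_apply_apply x

variable {Λ : X → (D →L[ℝ] ℝ) [⋀^Fin 2]→L[ℝ] ℝ} {E : X → D}

theorem contDiffOn_alternating_apply {k : ℕ} {f : X → D' [⋀^Fin k]→L[ℝ] ℝ} (hf : ContDiffOn ℝ n f s)
    (v : Fin k → D') : ContDiffOn ℝ n (fun x => f x v) s :=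
  (ContinuousAlternatingMap.apply ℝ D' ℝ v).contDiff.comp_contDiffOn hf

/-- Smoothness is only given for the pair `(Λ, E)`; pairing with `(β, 0)` recovers the coordinates
of the anchor, and hence `E`, `Λ^#` and `(Λ, E)^#`. -/
theorem contDiffOn_jacobiSharp_fst
    (hP : ContDiffOn ℝ n (fun x => pair (Λ x) (oneForm (evalAt (E x)))) s)
    (a : (D →L[ℝ] ℝ) × ℝ) : ContDiffOn ℝ n (fun x => (jacobiSharp (Λ x) (E x) a).1) s :=
  contDiffOn_of_dual fun β => by
    have := contDiffOn_alternating_apply hP ![a, (β, 0)]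
    simpa only [pair_oneForm_eq_jacobiSharp, zero_mul, add_zero] using this

theorem contDiffOn_vector
    (hP : ContDiffOn ℝ n (fun x => pair (Λ x) (oneForm (evalAt (E x)))) s) :
    ContDiffOn ℝ n E s := by
  simpa [jacobiSharp_fst] using contDiffOn_jacobiSharp_fst hP (0, 1)

theorem contDiffOn_jacobiSharp
    (hP : ContDiffOn ℝ n (fun x => pair (Λ x) (oneForm (evalAt (E x)))) s) :
    ContDiffOn ℝ n (fun x => LinearMap.toContinuousLinearMap (jacobiSharp (Λ x) (E x))) s :=
  contDiffOn_clm_apply.2 fun a => (contDiffOn_jacobiSharp_fst hP a).prodMk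
    ((a.1.contDiff.comp_contDiffOn (contDiffOn_vector hP)).neg)

theorem contDiffOn_sharp
    (hP : ContDiffOn ℝ n (fun x => pair (Λ x) (oneForm (evalAt (E x)))) s) :
    ContDiffOn ℝ n (fun x => LinearMap.toContinuousLinearMap (sharp (Λ x))) s :=
  contDiffOn_clm_apply.2 fun α => by
    simpa [jacobiSharp_fst] using contDiffOn_jacobiSharp_fst hP (α, 0)

theorem contDiffOn_lcsCovector
    (hP : ContDiffOn ℝ n (fun x => pair (Λ x) (oneForm (evalAt (E x)))) s)
    (hinj : ∀ x ∈ s, Function.Injective (sharp (Λ x))) {ϑ : X → D →L[ℝ] ℝ}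
    (hϑ : ∀ x ∈ s, sharp (Λ x) (ϑ x) = E x) : ContDiffOn ℝ n ϑ s := by
  refine ((contDiffOn_inverse (contDiffOn_sharp hP) fun x hx =>
    sharp_bijective (hinj x hx)).clm_apply (contDiffOn_vector hP)).congr fun x hx => ?_
  exact (inverse_apply_of_bijective (sharp_bijective (hinj x hx)) (hϑ x hx)).symm

theorem contDiffOn_lcsForm
    (hP : ContDiffOn ℝ n (fun x => pair (Λ x) (oneForm (evalAt (E x)))) s)
    (hinj : ∀ x ∈ s, Function.Injective (sharp (Λ x))) {Θ : X → D [⋀^Fin 2]→L[ℝ] ℝ}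
    (hΘ : ∀ x ∈ s, ∀ α v, Θ x ![sharp (Λ x) α, v] = -α v) : ContDiffOn ℝ n Θ s := by
  refine contDiffOn_alternating fun v => ?_
  have h := (((contDiffOn_inverse (contDiffOn_sharp hP) fun x hx =>
    sharp_bijective (hinj x hx)).clm_apply (contDiffOn_const (c := v 0))).clm_apply
      (contDiffOn_const (c := v 1))).neg
  refine h.congr fun x hx => ?_
  obtain ⟨α, hα⟩ := (sharp_bijective (hinj x hx)).2 (v 0)
  have e : v = ![sharp (Λ x) α, v 1] := by
    rw [hα]; ext i; fin_cases i <;> rfl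
  have h2 := inverse_apply_of_bijective (f := LinearMap.toContinuousLinearMap (sharp (Λ x)))
    (sharp_bijective (hinj x hx)) hα
  rw [h2]
  conv_lhs => rw [e]
  exact hΘ x hx α (v 1)

/-- The covector is the first component of `S⁻¹(0, -1)`, where `S = (Λ, E)^#`. -/
theorem contDiffOn_contactCovector
    (hP : ContDiffOn ℝ n (fun x => pair (Λ x) (oneForm (evalAt (E x)))) s)
    (hbij : ∀ x ∈ s, Function.Bijective (jacobiSharp (Λ x) (E x))) {ϑ : X → D →L[ℝ] ℝ}
    (hϑ : ∀ x ∈ s, sharp (Λ x) (ϑ x) = 0) (hϑE : ∀ x ∈ s, ϑ x (E x) = 1) :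
    ContDiffOn ℝ n ϑ s := by
  have h := ((contDiffOn_inverse (contDiffOn_jacobiSharp hP) hbij).clm_apply
    (contDiffOn_const (c := ((0 : D), (-1 : ℝ))))).fst
  refine h.congr fun x hx => ?_
  have h2 : jacobiSharp (Λ x) (E x) (ϑ x, 0) = (0, -1) := by
    refine Prod.ext ?_ ?_
    · rw [jacobiSharp_fst, hϑ x hx, zero_smul, add_zero]
    · rw [jacobiSharp_snd, hϑE x hx]
  exact (congrArg Prod.fst (inverse_apply_of_bijective
    (f := LinearMap.toContinuousLinearMap (jacobiSharp (Λ x) (E x))) (hbij x hx) h2)).symm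

end Smoothness

/-! ### The structure equation on a vector space. -/

section Flat

variable {V : Type*} [NormedAddCommGroup V] [NormedSpace ℝ V]

theorem extDeriv_two_apply (ω : V → V [⋀^Fin 2]→L[ℝ] ℝ) (y u v w : V) :
    extDeriv ω y ![u, v, w] =
      fderiv ℝ ω y u ![v, w] - fderiv ℝ ω y v ![u, w] + fderiv ℝ ω y w ![u, v] := by
  rw [extDeriv, ContinuousAlternatingMap.alternatizeUncurryFin_apply, Fin.sum_univ_three]
  have h0 : Fin.removeNth 0 ![u, v, w] = ![v, w] := by ext i; fin_cases i <;> rfl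
  have h1 : Fin.removeNth 1 ![u, v, w] = ![u, w] := by ext i; fin_cases i <;> rfl
  have h2 : Fin.removeNth 2 ![u, v, w] = ![u, v] := by ext i; fin_cases i <;> rfl
  rw [h0, h1, h2]
  simp [sub_eq_add_neg]

theorem extDeriv_oneForm_apply {ϑ : V → V →L[ℝ] ℝ} {y : V} (hϑ : DifferentiableAt ℝ ϑ y)
    (hϑ' : DifferentiableAt ℝ (fun y => oneForm (ϑ y)) y) (u v : V) :
    extDeriv (fun y => oneForm (ϑ y)) y ![u, v] = fderiv ℝ ϑ y u v - fderiv ℝ ϑ y v u := by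
  rw [extDeriv_apply hϑ', Fin.sum_univ_two]
  have h : ∀ a b : V, fderiv ℝ (fun y => ϑ y a) y b = fderiv ℝ ϑ y b a := fun a b => by
    rw [fderiv_clm_apply hϑ (differentiableAt_const a)]
    simp
  change (-1) ^ 0 • fderiv ℝ (fun y => ϑ y v) y u + (-1) ^ 1 • fderiv ℝ (fun y => ϑ y u) y v = _
  rw [h, h]
  simp [sub_eq_add_neg]

theorem fderiv_two_apply {D : Type*} [NormedAddCommGroup D] [NormedSpace ℝ D]
    {P : V → D [⋀^Fin 2]→L[ℝ] ℝ} {f g : V → D} {y : V} (hP : DifferentiableAt ℝ P y)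
    (hf : DifferentiableAt ℝ f y) (hg : DifferentiableAt ℝ g y) (h : V) :
    fderiv ℝ (fun y => P y ![f y, g y]) y h =
      fderiv ℝ P y h ![f y, g y] + P y ![fderiv ℝ f y h, g y] + P y ![f y, fderiv ℝ g y h] := by
  have hfg : ∀ i, DifferentiableAt ℝ ((![f, g] : Fin 2 → V → D) i) y := fun i => by
    fin_cases i
    · exact hf
    · exact hg
  have := fderiv_continuousAlternatingMap_apply_apply hP hfg h
  have e : ∀ z, (fun i => (![f, g] : Fin 2 → V → D) i z) = ![f z, g z] := fun z => by
    ext i; fin_cases i <;> rfl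
  simp only [e] at this
  rw [this, Fin.sum_univ_two, add_assoc]
  refine congrArg _ (congrArg₂ (· + ·) (congrArg _ ?_) (congrArg _ ?_)) <;>
  · ext i; fin_cases i <;> rfl

variable [FiniteDimensional ℝ V]

/-- For a 2-vector the two sums of the bracket agree, because 1- and 2-vectors commute under the
wedge. Summing over the basis assembles the contractions with `dx^a` into derivatives along `u`. -/
theorem half_schoutenFlatMod_apply (P : V → ((V →L[ℝ] ℝ) × ℝ) [⋀^Fin 2]→L[ℝ] ℝ) (y : V)
    {u : (V →L[ℝ] ℝ) × ℝ → V} {τ : (V →L[ℝ] ℝ) × ℝ → ℝ}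
    (hu : ∀ a β, P y ![a, (β, 0)] = β (u a)) (hτ : ∀ a, P y ![a, (0, 1)] = τ a)
    (a b c : (V →L[ℝ] ℝ) × ℝ) :
    (1 / 2 : ℝ) * schoutenFlatMod (p := 1) (q := 1) (0, 1) P P y (![a, b, c] : Fin 3 → _) =
      fderiv ℝ P y (u a) ![b, c] - fderiv ℝ P y (u b) ![a, c] + fderiv ℝ P y (u c) ![a, b] -
        (τ a * P y ![b, c] - τ b * P y ![a, c] + τ c * P y ![a, b]) := by
  have hsum : ∀ (w : V) (d : Fin 2 → (V →L[ℝ] ℝ) × ℝ),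
      fderiv ℝ P y w d = ∑ i, (Module.finBasis ℝ V).coord i w *
        fderiv ℝ P y (Module.finBasis ℝ V i) d := fun w d => by
    conv_lhs => rw [← (Module.finBasis ℝ V).sum_repr w]
    rw [map_sum, ContinuousAlternatingMap.sum_apply]
    simp
  have hc : ∀ i a, contract (schoutenFlat.dx (V := V) i) (P y) ![a] =
      -(Module.finBasis ℝ V).coord i (u a) := fun i a => by
    rw [contract_apply]
    refine (two_swap _ _ _).trans (congrArg _ ?_)
    exact hu a _
  have hκ : ∀ a, contract ((0, 1) : (V →L[ℝ] ℝ) × ℝ) (P y) ![a] = -τ a := fun a => by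
    rw [contract_apply]
    exact (two_swap _ _ _).trans (congrArg _ (hτ a))
  have h1 : ∀ i, (castDegree (Nat.add_right_comm 1 1 1)
      (wedge (fderiv ℝ P y (Module.finBasis ℝ V i)) (contract (schoutenFlat.dx i) (P y))))
        (![a, b, c] : Fin 3 → _) =
      wedge (contract (schoutenFlat.dx i) (P y)) (fderiv ℝ P y (Module.finBasis ℝ V i))
        (![a, b, c] : Fin 3 → _) := fun i =>
    (castDegree_apply _ _ _).trans ((wedge_two_one _ _ a b c).trans (wedge_one_two _ _ a b c).symm)
  have h2 : (castDegree (Nat.add_right_comm 1 1 1)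
      (wedge (P y) (contract ((0, 1) : (V →L[ℝ] ℝ) × ℝ) (P y)))) (![a, b, c] : Fin 3 → _) =
      wedge (contract ((0, 1) : (V →L[ℝ] ℝ) × ℝ) (P y)) (P y) (![a, b, c] : Fin 3 → _) :=
    (castDegree_apply _ _ _).trans ((wedge_two_one _ _ a b c).trans (wedge_one_two _ _ a b c).symm)
  have h3 : ∀ i, wedge (contract (schoutenFlat.dx i) (P y))
      (fderiv ℝ P y (Module.finBasis ℝ V i)) (![a, b, c] : Fin 3 → _) = _ :=
    fun i => wedge_one_two _ _ a b c
  have h4 : wedge (contract ((0, 1) : (V →L[ℝ] ℝ) × ℝ) (P y)) (P y) (![a, b, c] : Fin 3 → _) = _ :=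
    wedge_one_two _ _ a b c
  simp only [schoutenFlatMod, schoutenFlat, ContinuousAlternatingMap.add_apply,
    ContinuousAlternatingMap.sum_apply, ContinuousAlternatingMap.sub_apply,
    ContinuousAlternatingMap.smul_apply]
  simp only [h1, h2, smul_eq_mul]
  simp only [h3, h4, hc, hκ, hsum (u _)]
  -- The two cocycle corrections coincide, so the factor `1/2` leaves one of them.
  have e : ∀ x y z : ℝ, 1 / 2 * (x + (((1 : ℕ) : ℝ) * z) + (-1) ^ (1 + 1) * ((1 : ℕ) : ℝ) * z) =
      1 / 2 * x + z := fun x y z => by push_cast; ring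
  rw [e _ 0, Finset.mul_sum, ← Finset.sum_sub_distrib, ← Finset.sum_add_distrib]
  refine congrArg₂ (fun s t : ℝ => s + t) (Finset.sum_congr rfl fun i _ => ?_) ?_ |>.trans
    (sub_eq_add_neg _ _).symm
  · ring
  · ring

variable {Λ : V → (V →L[ℝ] ℝ) [⋀^Fin 2]→L[ℝ] ℝ} {E : V → V} {ω : V → V [⋀^Fin 2]→L[ℝ] ℝ} {y : V}

/-- The equation of a twisted Jacobi structure on `V` at the point `y`. -/
def TwistedJacobiEqAt (Λ : V → (V →L[ℝ] ℝ) [⋀^Fin 2]→L[ℝ] ℝ) (E : V → V)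
    (ω : V → V [⋀^Fin 2]→L[ℝ] ℝ) (y : V) : Prop :=
  ∀ a b c : (V →L[ℝ] ℝ) × ℝ, (1 / 2 : ℝ) *
    schoutenFlatMod (p := 1) (q := 1) (0, 1) (fun y => pair (Λ y) (oneForm (evalAt (E y))))
      (fun y => pair (Λ y) (oneForm (evalAt (E y)))) y (![a, b, c] : Fin 3 → _) =
    -pair (extDeriv ω y) (ω y) ![jacobiSharp (Λ y) (E y) a, jacobiSharp (Λ y) (E y) b,
      jacobiSharp (Λ y) (E y) c]

theorem TwistedJacobiEqAt.expand (H : TwistedJacobiEqAt Λ E ω y) (a b c : (V →L[ℝ] ℝ) × ℝ) :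
    let P := fun y => pair (Λ y) (oneForm (evalAt (E y)))
    let S := jacobiSharp (Λ y) (E y)
    fderiv ℝ P y (S a).1 ![b, c] - fderiv ℝ P y (S b).1 ![a, c] + fderiv ℝ P y (S c).1 ![a, b] -
      ((S a).2 * P y ![b, c] - (S b).2 * P y ![a, c] + (S c).2 * P y ![a, b]) =
    -(extDeriv ω y ![(S a).1, (S b).1, (S c).1] + (S a).2 * ω y ![(S b).1, (S c).1] -
      (S b).2 * ω y ![(S a).1, (S c).1] + (S c).2 * ω y ![(S a).1, (S b).1]) := by
  intro P S
  rw [← pair_three_apply]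
  refine (half_schoutenFlatMod_apply P y (u := fun a => (S a).1) (τ := fun a => (S a).2)
    (fun a β => ?_) (fun a => ?_) a b c).symm.trans (H a b c)
  · simp [P, S, pair_oneForm_eq_jacobiSharp]
  · simp [P, S, pair_oneForm_eq_jacobiSharp]

/-- Differentiating the constant `P((ϑ, s), b)` trades the derivative of `P` for that of `ϑ`. This
is how `dϑ` emerges from the structure equation. -/
theorem fderiv_pair_apply_of_eventually_const
    (hP : DifferentiableAt ℝ (fun y => pair (Λ y) (oneForm (evalAt (E y)))) y)
    {ϑ : V → V →L[ℝ] ℝ} (hϑ : DifferentiableAt ℝ ϑ y) {s : ℝ} {b : (V →L[ℝ] ℝ) × ℝ} {r : ℝ}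
    (hc : ∀ᶠ z in nhds y, pair (Λ z) (oneForm (evalAt (E z))) ![(ϑ z, s), b] = r) (h : V) :
    fderiv ℝ (fun y => pair (Λ y) (oneForm (evalAt (E y)))) y h ![(ϑ y, s), b] =
      fderiv ℝ ϑ y h (jacobiSharp (Λ y) (E y) b).1 := by
  have h1 := fderiv_two_apply hP (hϑ.prodMk (differentiableAt_const s)) (differentiableAt_const b) h
  have h2 : fderiv ℝ (fun z => pair (Λ z) (oneForm (evalAt (E z))) ![(ϑ z, s), b]) y = 0 := by
    rw [Filter.EventuallyEq.fderiv_eq (f := fun _ => r) hc, fderiv_const_apply]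
  have h3 : fderiv ℝ (fun z => (ϑ z, s)) y h = (fderiv ℝ ϑ y h, 0) := by
    rw [DifferentiableAt.fderiv_prodMk hϑ (differentiableAt_const s)]
    simp
  rw [h2, h3, two_swap (pair (Λ y) (oneForm (evalAt (E y)))) (fderiv ℝ ϑ y h, 0) b,
    pair_oneForm_eq_jacobiSharp, pair_oneForm_eq_jacobiSharp] at h1
  simp at h1
  linarith

/-- The Lee form of a transitive twisted Jacobi structure in even dimension is closed. -/
theorem TwistedJacobiEqAt.extDeriv_lcsCovector (H : TwistedJacobiEqAt Λ E ω y)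
    (hP : DifferentiableAt ℝ (fun y => pair (Λ y) (oneForm (evalAt (E y)))) y)
    {ϑ : V → V →L[ℝ] ℝ} (hϑ : DifferentiableAt ℝ ϑ y)
    (hϑ' : DifferentiableAt ℝ (fun y => oneForm (ϑ y)) y)
    (hE : ∀ᶠ z in nhds y, sharp (Λ z) (ϑ z) = E z)
    (hsurj : Function.Surjective (sharp (Λ y))) :
    extDeriv (fun y => oneForm (ϑ y)) y = 0 := by
  have hS : ∀ z, sharp (Λ z) (ϑ z) = E z → jacobiSharp (Λ z) (E z) (ϑ z, -1) = 0 := fun z hz => by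
    refine Prod.ext ?_ ?_
    · rw [jacobiSharp_fst, hz]; simp
    · rw [jacobiSharp_snd, ← hz, apply_sharp_self]; simp
  have hc : ∀ b, ∀ᶠ z in nhds y, pair (Λ z) (oneForm (evalAt (E z))) ![(ϑ z, -1), b] = 0 :=
    fun b => hE.mono fun z hz => by
      rw [pair_oneForm_eq_jacobiSharp, hS z hz]; simp
  ext v
  have hv : v = ![v 0, v 1] := by ext i; fin_cases i <;> rfl
  rw [hv]
  obtain ⟨β, hβ⟩ := hsurj (v 0)
  obtain ⟨γ, hγ⟩ := hsurj (v 1)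
  have hb : (jacobiSharp (Λ y) (E y) (β, 0)).1 = v 0 := by rw [jacobiSharp_fst, ← hβ]; simp
  have hg : (jacobiSharp (Λ y) (E y) (γ, 0)).1 = v 1 := by rw [jacobiSharp_fst, ← hγ]; simp
  -- Every term on the right contains a component of `S(ϑ, -1) = 0`; on the left only the
  -- antisymmetrised derivative of `ϑ` survives.
  have h := H.expand (ϑ y, -1) (β, 0) (γ, 0)
  simp only [hS y hE.self_of_nhds, fderiv_pair_apply_of_eventually_const hP hϑ (hc _),
    (hc _).self_of_nhds, hb, hg] at h
  have hz : extDeriv ω y ![(0 : V × ℝ).1, v 0, v 1] = 0 :=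
    (extDeriv ω y).map_coord_zero 0 rfl
  have hz' : ∀ u, ω y ![(0 : V × ℝ).1, u] = 0 := fun u => (ω y).map_coord_zero 0 rfl
  rw [hz, hz', hz'] at h
  simp at h
  rw [extDeriv_oneForm_apply hϑ hϑ']
  change _ = (0 : ℝ)
  linarith

/-- Under `Λ^#` the bivector corresponds to `Θ`, its derivative to minus that of `Θ`, and `-α(E)` to
`ϑ(Λ^# α)`. On triples `(α, 0)` the structure equation thus reads `-(dΘ + ϑ ∧ Θ) = -(dω + ϑ ∧ ω)`.
-/
theorem TwistedJacobiEqAt.extDeriv_lcsForm (H : TwistedJacobiEqAt Λ E ω y)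
    (hP : DifferentiableAt ℝ (fun y => pair (Λ y) (oneForm (evalAt (E y)))) y)
    (hS : ∀ α, DifferentiableAt ℝ (fun y => sharp (Λ y) α) y)
    {ϑ : V →L[ℝ] ℝ} (hE : sharp (Λ y) ϑ = E y)
    (hsurj : Function.Surjective (sharp (Λ y)))
    {Θ : V → V [⋀^Fin 2]→L[ℝ] ℝ} (hΘd : DifferentiableAt ℝ Θ y) (hωd : DifferentiableAt ℝ ω y)
    (hΘ : ∀ᶠ z in nhds y, ∀ α v, Θ z ![sharp (Λ z) α, v] = -α v) (u v w : V) :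
    extDeriv (fun y => Θ y - ω y) y ![u, v, w] +
      wedge (oneForm ϑ) (Θ y - ω y) (![u, v, w] : Fin 3 → V) = 0 := by
  have hD : ∀ (h : V) (β γ : V →L[ℝ] ℝ),
      fderiv ℝ (fun y => pair (Λ y) (oneForm (evalAt (E y)))) y h ![(β, 0), (γ, 0)] =
        -fderiv ℝ Θ y h ![sharp (Λ y) β, sharp (Λ y) γ] := fun h β γ => by
    -- The rule for differentiating an inverse: `Θ(Λ^# β, w) = -β(w)` is constant for the frozen
    -- vector `w = Λ^# γ` at `y`.
    have h1 := fderiv_two_apply hΘd (hS β) (differentiableAt_const (sharp (Λ y) γ)) h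
    have h2 : fderiv ℝ (fun z => Θ z ![sharp (Λ z) β, sharp (Λ y) γ]) y = 0 := by
      rw [Filter.EventuallyEq.fderiv_eq (f := fun _ => -β (sharp (Λ y) γ))
        (hΘ.mono fun z hz => hz β _), fderiv_const_apply]
    have h3 := fderiv_two_apply hP (differentiableAt_const ((β, 0) : (V →L[ℝ] ℝ) × ℝ))
      (differentiableAt_const ((γ, 0) : (V →L[ℝ] ℝ) × ℝ)) h
    have h4 : (fun z => pair (Λ z) (oneForm (evalAt (E z))) ![(β, 0), (γ, 0)]) =
        fun z => γ (sharp (Λ z) β) := by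
      funext z
      rw [pair_oneForm_eq_jacobiSharp, jacobiSharp_fst]; simp
    have h5 : fderiv ℝ (fun z => γ (sharp (Λ z) β)) y h =
        γ (fderiv ℝ (fun z => sharp (Λ z) β) y h) := by
      have := (γ.hasFDerivAt.comp y (hS β).hasFDerivAt).fderiv
      exact congrArg (fun l => l h) this
    have h6 := hΘ.self_of_nhds γ (fderiv ℝ (fun z => sharp (Λ z) β) y h)
    have hz : ∀ c : V, Θ y ![c, 0] = 0 := fun c => (Θ y).map_coord_zero 1 rfl
    have hz1 : ∀ c, pair (Λ y) (oneForm (evalAt (E y))) ![c, 0] = 0 := fun c =>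
      (pair (Λ y) (oneForm (evalAt (E y)))).map_coord_zero 1 rfl
    have hz2 : ∀ c, pair (Λ y) (oneForm (evalAt (E y))) ![0, c] = 0 := fun c =>
      (pair (Λ y) (oneForm (evalAt (E y)))).map_coord_zero 0 rfl
    rw [h4, h5] at h3
    rw [h2, two_swap (Θ y) _ (sharp (Λ y) γ), h6] at h1
    simp only [fderiv_fun_const, Pi.zero_apply, zero_apply, hz, hz1, hz2] at h1 h3
    linarith
  have hd : ∀ h, fderiv ℝ (fun y => Θ y - ω y) y h = fderiv ℝ Θ y h - fderiv ℝ ω y h := fun h => by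
    rw [fderiv_fun_sub hΘd hωd]; rfl
  obtain ⟨α, rfl⟩ := hsurj u
  obtain ⟨β, rfl⟩ := hsurj v
  obtain ⟨γ, rfl⟩ := hsurj w
  have hS1 : ∀ α, (jacobiSharp (Λ y) (E y) (α, 0)).1 = sharp (Λ y) α := fun α => by
    rw [jacobiSharp_fst]; simp
  have hS2 : ∀ α, (jacobiSharp (Λ y) (E y) (α, 0)).2 = ϑ (sharp (Λ y) α) := fun α => by
    rw [jacobiSharp_snd, ← hE, apply_sharp_swap]; simp
  have hP' : ∀ β γ : V →L[ℝ] ℝ, pair (Λ y) (oneForm (evalAt (E y))) ![(β, 0), (γ, 0)] =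
      Θ y ![sharp (Λ y) β, sharp (Λ y) γ] := fun β γ => by
    rw [hΘ.self_of_nhds, pair_oneForm_eq_jacobiSharp, hS1, apply_sharp_swap]; simp
  have h := H.expand (α, 0) (β, 0) (γ, 0)
  simp only [hD, hS1, hS2, hP', extDeriv_two_apply] at h
  have hw := wedge_one_two (oneForm ϑ) (Θ y - ω y) (sharp (Λ y) α) (sharp (Λ y) β) (sharp (Λ y) γ)
  refine (congrArg _ hw).trans ?_
  simp only [extDeriv_two_apply, hd, ContinuousAlternatingMap.sub_apply, oneForm_apply,
    Matrix.cons_val_zero]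
  linarith

/-- The relation between the contact form and the twist in odd dimension. -/
theorem TwistedJacobiEqAt.extDeriv_contactCovector (H : TwistedJacobiEqAt Λ E ω y)
    (hP : DifferentiableAt ℝ (fun y => pair (Λ y) (oneForm (evalAt (E y)))) y)
    {ϑ : V → V →L[ℝ] ℝ} (hϑ : DifferentiableAt ℝ ϑ y)
    (hϑ' : DifferentiableAt ℝ (fun y => oneForm (ϑ y)) y)
    (hs : ∀ᶠ z in nhds y, sharp (Λ z) (ϑ z) = 0) (hE : ∀ᶠ z in nhds y, ϑ z (E z) = 1)
    {b c : (V →L[ℝ] ℝ) × ℝ} (hb : b.1 (E y) = 0) (hc : c.1 (E y) = 0) :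
    (extDeriv (fun y => oneForm (ϑ y)) y + ω y)
      ![(jacobiSharp (Λ y) (E y) b).1, (jacobiSharp (Λ y) (E y) c).1] =
      c.1 (jacobiSharp (Λ y) (E y) b).1 := by
  have hS : ∀ z, sharp (Λ z) (ϑ z) = 0 → ϑ z (E z) = 1 →
      jacobiSharp (Λ z) (E z) (ϑ z, 0) = (0, -1) := fun z hz hz' => by
    refine Prod.ext ?_ ?_
    · rw [jacobiSharp_fst, hz]; simp
    · rw [jacobiSharp_snd, hz']
  have hk : ∀ b : (V →L[ℝ] ℝ) × ℝ, ∀ᶠ z in nhds y,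
      pair (Λ z) (oneForm (evalAt (E z))) ![(ϑ z, 0), b] = -b.2 :=
    fun b => (hs.and hE).mono fun z hz => by
      rw [pair_oneForm_eq_jacobiSharp, hS z hz.1 hz.2]; simp
  -- As `S(ϑ, 0) = (0, -1)`, the `dω` term drops out and the scalar slot brings in `ω(S b, S c)` on
  -- one side and `P(b, c)` on the other.
  have h := H.expand (ϑ y, 0) b c
  have hb2 : (jacobiSharp (Λ y) (E y) b).2 = 0 := by rw [jacobiSharp_snd, hb, neg_zero]
  have hc2 : (jacobiSharp (Λ y) (E y) c).2 = 0 := by rw [jacobiSharp_snd, hc, neg_zero]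
  simp only [hS y hs.self_of_nhds hE.self_of_nhds,
    fderiv_pair_apply_of_eventually_const hP hϑ (hk _), hb2, hc2,
    pair_oneForm_eq_jacobiSharp (Λ y) (E y) b c] at h
  have hz : ∀ u v, extDeriv ω y ![0, u, v] = 0 := fun u v =>
    (extDeriv ω y).map_coord_zero 0 rfl
  rw [hz] at h
  simp at h
  rw [ContinuousAlternatingMap.add_apply, extDeriv_oneForm_apply hϑ hϑ']
  linarith

end Flat

/-! ### Transport of the fields to a chart. -/

section Charts

variable {V : Type*} [NormedAddCommGroup V] [NormedSpace ℝ V]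
  {M : Type*} [TopologicalSpace M] [ChartedSpace V M]

/-- The image of a form at `z` under the chart centred at `x`. -/
noncomputable def pushForm {k : ℕ} (η : Form V M k) (x z : M) : V [⋀^Fin k]→L[ℝ] ℝ :=
  (η z).compContinuousLinearMap (chartDeriv x z).inverse

/-- The image of a covector at `z` under the chart centred at `x`. -/
noncomputable def pushCovector (ϑ : CovectorField V M) (x z : M) : V →L[ℝ] ℝ :=
  (ϑ z).comp (chartDeriv x z).inverse

/-- The image of a bivector at `z` under the chart centred at `x`. -/
noncomputable def pushBivector (Λ : BivectorField V M) (x z : M) : (V →L[ℝ] ℝ) [⋀^Fin 2]→L[ℝ] ℝ :=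
  (Λ z).compContinuousLinearMap (ContinuousLinearMap.precomp ℝ (chartDeriv x z))

/-- The image of a vector at `z` under the chart centred at `x`. -/
noncomputable def pushVector (E : VField V M) (x z : M) : V := chartDeriv x z (E z)

theorem pushForm_toForm (ϑ : CovectorField V M) (x z : M) :
    pushForm ϑ.toForm x z = oneForm (pushCovector ϑ x z) := rfl

theorem pair_compContinuousLinearMap_dualProd {U U' : Type*} [AddCommGroup U] [Module ℝ U]
    [TopologicalSpace U] [AddCommGroup U'] [Module ℝ U'] [TopologicalSpace U']
    [ContinuousSMul ℝ U] [ContinuousSMul ℝ U']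
    (Λ : (U →L[ℝ] ℝ) [⋀^Fin 2]→L[ℝ] ℝ) (E : U) (T : U →L[ℝ] U') :
    (pair Λ (oneForm (evalAt E))).compContinuousLinearMap (dualProd T) =
      pair (Λ.compContinuousLinearMap (ContinuousLinearMap.precomp ℝ T))
        (oneForm (evalAt (T E))) := by
  ext v
  have hv : v = ![v 0, v 1] := by ext1 i; fin_cases i <;> rfl
  have hv' : dualProd T ∘ v = ![dualProd T (v 0), dualProd T (v 1)] := by
    ext1 i; fin_cases i <;> rfl
  conv_rhs => rw [hv, pair_oneForm_apply]
  rw [ContinuousAlternatingMap.compContinuousLinearMap_apply, hv', pair_oneForm_apply]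
  refine congrArg (fun t => t + _ - _) (congrArg Λ ?_)
  ext1 i; fin_cases i <;> rfl

theorem jacobiSection_inChart (Λ : BivectorField V M) (E : VField V M) (x : M) :
    (jacobiSection Λ E).inChart x = fun y =>
      pair (pushBivector Λ x ((extChartAt 𝓘(ℝ, V) x).symm y))
        (oneForm (evalAt (pushVector E x ((extChartAt 𝓘(ℝ, V) x).symm y)))) :=
  funext fun _ => pair_compContinuousLinearMap_dualProd _ _ _

section

variable [FiniteDimensional ℝ V]

theorem sharp_pushBivector (Λ : BivectorField V M) (x z : M) (α : V →L[ℝ] ℝ) :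
    sharp (pushBivector Λ x z) α = chartDeriv x z (sharp (Λ z) (α.comp (chartDeriv x z))) :=
  sharp_compContinuousLinearMap _ _ _

theorem jacobiSharp_push (Λ : BivectorField V M) (E : VField V M) (x z : M)
    (a : (V →L[ℝ] ℝ) × ℝ) :
    jacobiSharp (pushBivector Λ x z) (pushVector E x z) a =
      (chartDeriv x z (jacobiSharp (Λ z) (E z) (dualProd (chartDeriv x z) a)).1,
        (jacobiSharp (Λ z) (E z) (dualProd (chartDeriv x z) a)).2) := by
  refine Prod.ext ?_ rfl
  change sharp _ _ + a.2 • chartDeriv x z (E z) = chartDeriv x z (sharp (Λ z) _ + a.2 • E z)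
  rw [sharp_pushBivector, map_add, map_smul]
  rfl

theorem IsTransitive.anchorSurjective {Λ : BivectorField V M} {E : VField V M}
    (hT : IsTransitive Λ E) (z : M) : AnchorSurjective (Λ z) (E z) := by
  have h : LinearMap.range (anchor Λ E z) = ⊤ := Submodule.eq_top_of_finrank_eq (hT z)
  exact LinearMap.range_eq_top.1 h

end

variable [IsManifold 𝓘(ℝ, V) (⊤ : ℕ∞) M]

theorem isInvertible_chartDeriv {x z : M} (hz : z ∈ (extChartAt 𝓘(ℝ, V) x).source) :
    (chartDeriv (V := V) x z).IsInvertible := by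
  have : IsManifold 𝓘(ℝ, V) 1 M := IsManifold.of_le (n := (⊤ : ℕ∞)) (by simp)
  obtain ⟨e, he⟩ := isInvertible_mfderiv_extChartAt (I := 𝓘(ℝ, V)) hz
  refine ⟨e.trans (NormedSpace.fromTangentSpace (extChartAt 𝓘(ℝ, V) x z)), ?_⟩
  rw [chartDeriv, ← he]
  rfl

/-- Forms are transported by the derivative of the inverse chart and multivectors by that of the
chart; their pairings can be compared once these are known to be mutually inverse. -/
theorem chartSymmDeriv_eq_inverse {x : M} {y : V} (hy : y ∈ (extChartAt 𝓘(ℝ, V) x).target) :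
    chartSymmDeriv x y = (chartDeriv x ((extChartAt 𝓘(ℝ, V) x).symm y)).inverse := by
  have : IsManifold 𝓘(ℝ, V) 1 M := IsManifold.of_le (n := (⊤ : ℕ∞)) (by simp)
  have hz := (extChartAt 𝓘(ℝ, V) x).map_target hy
  have hinv := isInvertible_chartDeriv (V := V) hz
  have h := mfderiv_extChartAt_comp_mfderivWithin_extChartAt_symm (I := 𝓘(ℝ, V)) hy
  rw [ModelWithCorners.range_eq_univ, mfderivWithin_univ] at h
  ext v
  rw [eq_comm, hinv.inverse_apply_eq]
  exact (congrArg (fun l => l v) h).symm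

theorem chartDeriv_inverse_apply {x z : M} (hz : z ∈ (extChartAt 𝓘(ℝ, V) x).source) (v : V) :
    chartDeriv x z ((chartDeriv x z).inverse v) = v :=
  (isInvertible_chartDeriv hz).self_apply_inverse v

theorem inverse_chartDeriv_apply {x z : M} (hz : z ∈ (extChartAt 𝓘(ℝ, V) x).source)
    (v : TangentSpace 𝓘(ℝ, V) z) :
    (chartDeriv x z).inverse (chartDeriv x z v) = v :=
  (isInvertible_chartDeriv hz).inverse_apply_self v

theorem inChart_eq_pushForm {k : ℕ} (η : Form V M k) {x : M} {y : V}
    (hy : y ∈ (extChartAt 𝓘(ℝ, V) x).target) :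
    η.inChart x y = pushForm η x ((extChartAt 𝓘(ℝ, V) x).symm y) := by
  rw [Form.inChart, chartSymmDeriv_eq_inverse hy, pushForm]

theorem pushForm_apply {k : ℕ} (η : Form V M k) {x z : M}
    (hz : z ∈ (extChartAt 𝓘(ℝ, V) x).source) (v : Fin k → TangentSpace 𝓘(ℝ, V) z) :
    pushForm η x z (fun i => chartDeriv x z (v i)) = η z v :=
  congrArg (η z) (funext fun i => inverse_chartDeriv_apply hz (v i))

variable [FiniteDimensional ℝ V]

/-- The image in the chart of the equation of a twisted Jacobi structure. -/
theorem IsTwistedJacobi.twistedJacobiEqAt {Λ : BivectorField V M} {E : VField V M}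
    {ω : Form V M 2} (hJ : IsTwistedJacobi Λ E ω) (x : M) :
    TwistedJacobiEqAt (fun y => pushBivector Λ x ((extChartAt 𝓘(ℝ, V) x).symm y))
      (fun y => pushVector E x ((extChartAt 𝓘(ℝ, V) x).symm y)) (ω.inChart x)
      (extChartAt 𝓘(ℝ, V) x x) := by
  intro a b c
  have hx := mem_extChartAt_source (I := 𝓘(ℝ, V)) x
  have hy := mem_extChartAt_target (I := 𝓘(ℝ, V)) x
  have hxx := (extChartAt 𝓘(ℝ, V) x).left_inv hx
  -- The arguments are pulled back so that the transport in `schouten01` returns `a`, `b`, `c`.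
  have h := hJ.schouten_eq x (![dualProd (chartDeriv x x) a, dualProd (chartDeriv x x) b,
    dualProd (chartDeriv x x) c])
  have hdual : ∀ a, dualProd (chartDeriv x x).inverse (dualProd (chartDeriv (V := V) x x) a) =
      a := by
    intro a
    refine Prod.ext ?_ rfl
    ext v
    exact congrArg a.1 (chartDeriv_inverse_apply hx v)
  have h1 : schouten01 (jacobiSection Λ E) (jacobiSection Λ E) x
      (![dualProd (chartDeriv x x) a, dualProd (chartDeriv x x) b,
        dualProd (chartDeriv x x) c]) =
      schoutenFlatMod (p := 1) (q := 1) (0, 1) ((jacobiSection Λ E).inChart x)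
        ((jacobiSection Λ E).inChart x) (extChartAt 𝓘(ℝ, V) x x) (![a, b, c] : Fin 3 → _) := by
    change schoutenFlatMod (p := 1) (q := 1) (0, 1) ((jacobiSection Λ E).inChart x)
      ((jacobiSection Λ E).inChart x) (extChartAt 𝓘(ℝ, V) x x)
      (fun i => dualProd (chartDeriv x x).inverse ((![dualProd (chartDeriv x x) a,
        dualProd (chartDeriv x x) b, dualProd (chartDeriv x x) c] : Fin 3 → _) i)) = _
    refine congrArg _ ?_
    ext1 i
    fin_cases i
    · exact hdual a
    · exact hdual b
    · exact hdual c
  rw [h1, jacobiSection_inChart] at h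
  refine h.trans ?_
  have h2 : (fun i => jacobiSharp (Λ x) (E x) ((![dualProd (chartDeriv x x) a,
      dualProd (chartDeriv x x) b, dualProd (chartDeriv x x) c] : Fin 3 → _) i)) =
      ![jacobiSharp (Λ x) (E x) (dualProd (chartDeriv x x) a),
        jacobiSharp (Λ x) (E x) (dualProd (chartDeriv x x) b),
        jacobiSharp (Λ x) (E x) (dualProd (chartDeriv x x) c)] := by
    ext1 i; fin_cases i <;> rfl
  rw [jacobiSharpExt, h2, inChart_eq_pushForm _ hy, hxx, pair_three_apply, pair_three_apply]
  have hS : ∀ a, jacobiSharp (pushBivector Λ x ((extChartAt 𝓘(ℝ, V) x).symm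
      (extChartAt 𝓘(ℝ, V) x x))) (pushVector E x ((extChartAt 𝓘(ℝ, V) x).symm
        (extChartAt 𝓘(ℝ, V) x x))) a = jacobiSharp (pushBivector Λ x x) (pushVector E x x) a := by
    rw [hxx]; exact fun _ => rfl
  simp only [hS, jacobiSharp_push]
  have h3 : ∀ u v w : TangentSpace 𝓘(ℝ, V) x, Form.d ω x ![u, v, w] =
      extDeriv (ω.inChart x) (extChartAt 𝓘(ℝ, V) x x)
        ![chartDeriv x x u, chartDeriv x x v, chartDeriv x x w] := fun u v w => by
    change extDeriv (ω.inChart x) (extChartAt 𝓘(ℝ, V) x x)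
      (fun i => chartDeriv x x ((![u, v, w] : Fin 3 → TangentSpace 𝓘(ℝ, V) x) i)) = _
    refine congrArg _ ?_
    ext1 i; fin_cases i <;> rfl
  have h4 : ∀ u v : TangentSpace 𝓘(ℝ, V) x, ω x ![u, v] =
      pushForm ω x x ![chartDeriv x x u, chartDeriv x x v] := fun u v => by
    rw [← pushForm_apply ω hx]
    refine congrArg _ ?_
    ext1 i; fin_cases i <;> rfl
  rw [h3, h4, h4, h4]
  -- The minus sign in `TwistedJacobiEqAt` is the factor `(-1)^3` of `jacobiSharpExt`.
  ring

end Charts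

/-! ### Global structures from transitive twisted Jacobi structures. -/

section Transitive

variable {V : Type*} [NormedAddCommGroup V] [NormedSpace ℝ V]
  {M : Type*} [TopologicalSpace M] [ChartedSpace V M]

theorem differentiableAt_of_contDiffOn_target {F : Type*} [NormedAddCommGroup F] [NormedSpace ℝ F]
    {x : M} {f : V → F} (h : ContDiffOn ℝ (⊤ : ℕ∞) f (extChartAt 𝓘(ℝ, V) x).target) :
    DifferentiableAt ℝ f (extChartAt 𝓘(ℝ, V) x x) :=
  (h.contDiffAt (extChartAt_target_mem_nhds x)).differentiableAt (by simp)

theorem IsTwistedJacobi.contDiffOn_pair [FiniteDimensional ℝ V]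
    {Λ : BivectorField V M} {E : VField V M} {ω : Form V M 2} (hJ : IsTwistedJacobi Λ E ω) (x : M) :
    ContDiffOn ℝ (⊤ : ℕ∞) (fun y =>
      pair (pushBivector Λ x ((extChartAt 𝓘(ℝ, V) x).symm y))
        (oneForm (evalAt (pushVector E x ((extChartAt 𝓘(ℝ, V) x).symm y)))))
      (extChartAt 𝓘(ℝ, V) x).target := by
  rw [← jacobiSection_inChart]
  exact hJ.smooth_jacobiSection x

variable [IsManifold 𝓘(ℝ, V) (⊤ : ℕ∞) M]

theorem pushCovector_pushVector {E : VField V M} {ϑ : CovectorField V M} {x z : M}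
    (hz : z ∈ (extChartAt 𝓘(ℝ, V) x).source) :
    pushCovector ϑ x z (pushVector E x z) = ϑ z (E z) :=
  congrArg (ϑ z) (inverse_chartDeriv_apply hz (E z))

theorem pushForm_two_apply (η : Form V M 2) {x z : M} (hz : z ∈ (extChartAt 𝓘(ℝ, V) x).source)
    (u v : TangentSpace 𝓘(ℝ, V) z) :
    pushForm η x z ![chartDeriv x z u, chartDeriv x z v] = η z ![u, v] := by
  rw [← pushForm_apply η hz]
  refine congrArg _ ?_
  ext1 i; fin_cases i <;> rfl

theorem CovectorField.toForm_isSmooth_of_push {ϑ : CovectorField V M} [FiniteDimensional ℝ V]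
    (h : ∀ x : M, ContDiffOn ℝ (⊤ : ℕ∞)
      (fun y => pushCovector ϑ x ((extChartAt 𝓘(ℝ, V) x).symm y))
      (extChartAt 𝓘(ℝ, V) x).target) : ϑ.toForm.IsSmooth := fun x =>
  (contDiffOn_alternating (f := fun y =>
    oneForm (pushCovector ϑ x ((extChartAt 𝓘(ℝ, V) x).symm y))) fun v =>
      (h x).clm_apply contDiffOn_const).congr fun y hy => by
    rw [inChart_eq_pushForm _ hy, pushForm_toForm]

theorem toForm_d_apply (ϑ : CovectorField V M) (x : M) (v : Fin 2 → TangentSpace 𝓘(ℝ, V) x) :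
    ϑ.toForm.d x v = extDeriv
      (fun y => oneForm (pushCovector ϑ x ((extChartAt 𝓘(ℝ, V) x).symm y)))
      (extChartAt 𝓘(ℝ, V) x x) (fun i => chartDeriv x x (v i)) := by
  have h : ϑ.toForm.inChart x =ᶠ[nhds (extChartAt 𝓘(ℝ, V) x x)]
      fun y => oneForm (pushCovector ϑ x ((extChartAt 𝓘(ℝ, V) x).symm y)) := by
    filter_upwards [extChartAt_target_mem_nhds (I := 𝓘(ℝ, V)) x] with y hy
    rw [inChart_eq_pushForm _ hy, pushForm_toForm]
  rw [← h.extDeriv_eq]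
  rfl

variable [FiniteDimensional ℝ V]
  {Λ : BivectorField V M} {E : VField V M} {ω Θ : Form V M 2} {ϑ : CovectorField V M}

theorem sharp_pushBivector_pushCovector {x z : M} (hz : z ∈ (extChartAt 𝓘(ℝ, V) x).source) :
    sharp (pushBivector Λ x z) (pushCovector ϑ x z) = chartDeriv x z (sharp (Λ z) (ϑ z)) := by
  rw [sharp_pushBivector]
  congr 2
  ext v
  exact congrArg (ϑ z) (inverse_chartDeriv_apply hz v)

theorem sharp_pushBivector_injective {x z : M} (hz : z ∈ (extChartAt 𝓘(ℝ, V) x).source)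
    (h : Function.Injective (sharp (Λ z))) : Function.Injective (sharp (pushBivector Λ x z)) := by
  intro α β hαβ
  rw [sharp_pushBivector, sharp_pushBivector] at hαβ
  have h1 := congrArg (chartDeriv x z).inverse hαβ
  rw [inverse_chartDeriv_apply hz, inverse_chartDeriv_apply hz] at h1
  have h2 := h h1
  ext v
  have h3 := congrArg (fun l => l ((chartDeriv x z).inverse v)) h2
  simpa only [ContinuousLinearMap.comp_apply, chartDeriv_inverse_apply hz] using h3

theorem AnchorSurjective.push {x z : M} (hz : z ∈ (extChartAt 𝓘(ℝ, V) x).source)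
    (h : AnchorSurjective (Λ z) (E z)) :
    AnchorSurjective (pushBivector Λ x z) (pushVector E x z) := by
  intro u
  obtain ⟨a, ha⟩ := h ((chartDeriv x z).inverse u)
  refine ⟨dualProd (chartDeriv x z).inverse a, ?_⟩
  have e : dualProd (chartDeriv x z) (dualProd (chartDeriv x z).inverse a) = a := by
    refine Prod.ext ?_ rfl
    ext v
    exact congrArg a.1 (inverse_chartDeriv_apply hz v)
  rw [jacobiSharp_push, e, ha, chartDeriv_inverse_apply hz]

theorem pushForm_sharp {x z : M} (hz : z ∈ (extChartAt 𝓘(ℝ, V) x).source)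
    (h : ∀ α v, Θ z ![sharp (Λ z) α, v] = -α v) (α : V →L[ℝ] ℝ) (v : V) :
    pushForm Θ x z ![sharp (pushBivector Λ x z) α, v] = -α v := by
  have := pushForm_two_apply Θ hz (sharp (Λ z) (α.comp (chartDeriv x z)))
    ((chartDeriv x z).inverse v)
  rw [chartDeriv_inverse_apply hz] at this
  rw [sharp_pushBivector, this, h, ContinuousLinearMap.comp_apply, chartDeriv_inverse_apply hz]

/-- A transitive twisted Jacobi structure with invertible `Λ^#` comes from a twisted locally
conformal symplectic structure. -/
theorem IsTwistedJacobi.isTwistedLCS (hJ : IsTwistedJacobi Λ E ω)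
    (heven : Even (Module.finrank ℝ V)) (hinj : ∀ x, Function.Injective (sharp (Λ x)))
    (hϑ : ∀ x, sharp (Λ x) (ϑ x) = E x) (hΘ : ∀ x α v, Θ x ![sharp (Λ x) α, v] = -α v) :
    IsTwistedLCS ϑ Θ ω := by
  have hsource : ∀ (x : M) {y : V}, y ∈ (extChartAt 𝓘(ℝ, V) x).target →
      (extChartAt 𝓘(ℝ, V) x).symm y ∈ (extChartAt 𝓘(ℝ, V) x).source :=
    fun x y hy => (extChartAt 𝓘(ℝ, V) x).map_target hy
  have hinj' : ∀ x, ∀ y ∈ (extChartAt 𝓘(ℝ, V) x).target,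
      Function.Injective (sharp (pushBivector Λ x ((extChartAt 𝓘(ℝ, V) x).symm y))) :=
    fun x y hy => sharp_pushBivector_injective (hsource x hy) (hinj _)
  have hϑ' : ∀ x, ∀ y ∈ (extChartAt 𝓘(ℝ, V) x).target,
      sharp (pushBivector Λ x ((extChartAt 𝓘(ℝ, V) x).symm y))
        (pushCovector ϑ x ((extChartAt 𝓘(ℝ, V) x).symm y)) =
      pushVector E x ((extChartAt 𝓘(ℝ, V) x).symm y) := fun x y hy => by
    rw [sharp_pushBivector_pushCovector (hsource x hy), hϑ]; rfl
  have hΘ' : ∀ x, ∀ y ∈ (extChartAt 𝓘(ℝ, V) x).target, ∀ α v,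
      Θ.inChart x y ![sharp (pushBivector Λ x ((extChartAt 𝓘(ℝ, V) x).symm y)) α, v] = -α v :=
    fun x y hy α v => by
      rw [inChart_eq_pushForm Θ hy]
      exact pushForm_sharp (hsource x hy) (hΘ _) α v
  have hϑs := fun x => contDiffOn_lcsCovector (hJ.contDiffOn_pair x) (hinj' x) (hϑ' x)
  have hϑs' : ϑ.toForm.IsSmooth := CovectorField.toForm_isSmooth_of_push hϑs
  have hΘs : Θ.IsSmooth := fun x => contDiffOn_lcsForm (hJ.contDiffOn_pair x) (hinj' x) (hΘ' x)
  have htarget := fun x : M => extChartAt_target_mem_nhds (I := 𝓘(ℝ, V)) x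
  have hmem := fun x : M => mem_extChartAt_target (I := 𝓘(ℝ, V)) x
  have hone : ∀ x : M, DifferentiableAt ℝ
      (fun y => oneForm (pushCovector ϑ x ((extChartAt 𝓘(ℝ, V) x).symm y)))
      (extChartAt 𝓘(ℝ, V) x x) := fun x =>
    differentiableAt_of_contDiffOn_target <| contDiffOn_alternating fun v =>
      (hϑs x).clm_apply contDiffOn_const
  refine ⟨heven, hϑs', hΘs, hJ.smooth_form, fun x u hu => ?_, fun x => ?_, fun x => ?_⟩
  · obtain ⟨α, rfl⟩ := (sharp_bijective (hinj x)).2 u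
    have : α = 0 := by
      ext v
      have := hΘ x α v
      rw [hu] at this
      simpa using this.symm
    rw [this, map_zero]
  · ext v
    rw [toForm_d_apply, (hJ.twistedJacobiEqAt x).extDeriv_lcsCovector
      (differentiableAt_of_contDiffOn_target (hJ.contDiffOn_pair x))
      (differentiableAt_of_contDiffOn_target (hϑs x)) (hone x)
      (Filter.mem_of_superset (htarget x) (hϑ' x))
      (sharp_bijective (hinj' x _ (hmem x))).2]
    rfl
  · ext v
    have hx := mem_extChartAt_source (I := 𝓘(ℝ, V)) x
    have hxx := (extChartAt 𝓘(ℝ, V) x).left_inv hx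
    have h := (hJ.twistedJacobiEqAt x).extDeriv_lcsForm
      (differentiableAt_of_contDiffOn_target (hJ.contDiffOn_pair x))
      (fun α => differentiableAt_of_contDiffOn_target
        ((contDiffOn_sharp (hJ.contDiffOn_pair x)).clm_apply contDiffOn_const))
      (hϑ' x _ (hmem x)) (sharp_bijective (hinj' x _ (hmem x))).2
      (differentiableAt_of_contDiffOn_target (hΘs x))
      (differentiableAt_of_contDiffOn_target (hJ.smooth_form x))
      (Filter.mem_of_superset (htarget x) (hΘ' x))
      (chartDeriv x x (v 0)) (chartDeriv x x (v 1)) (chartDeriv x x (v 2))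
    rw [inChart_eq_pushForm _ (hmem x), inChart_eq_pushForm _ (hmem x), hxx] at h
    have h1 : Form.d (Θ - ω) x v = extDeriv (fun y => Θ.inChart x y - ω.inChart x y)
        (extChartAt 𝓘(ℝ, V) x x)
        ![chartDeriv x x (v 0), chartDeriv x x (v 1), chartDeriv x x (v 2)] := by
      change extDeriv (fun y => Θ.inChart x y - ω.inChart x y) (extChartAt 𝓘(ℝ, V) x x)
        (fun i => chartDeriv x x (v i)) = _
      refine congrArg _ ?_
      ext1 i; fin_cases i <;> rfl
    have h2 : castDegree (Nat.add_comm 1 2) (wedge (ϑ.toForm x) ((Θ - ω) x)) v =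
        wedge (oneForm (pushCovector ϑ x x)) (pushForm Θ x x - pushForm ω x x)
          (![chartDeriv x x (v 0), chartDeriv x x (v 1), chartDeriv x x (v 2)] : Fin 3 → V) := by
      have hv : (fun i => v (Fin.cast (Nat.add_comm 1 2) i)) = ![v 0, v 1, v 2] := by
        ext1 i; fin_cases i <;> rfl
      rw [castDegree_apply, hv]
      refine (wedge_one_two _ _ _ _ _).trans (Eq.trans ?_ (wedge_one_two _ _ _ _ _).symm)
      simp only [ContinuousAlternatingMap.sub_apply, pushForm_two_apply _ hx, oneForm_apply,
        Matrix.cons_val_zero, pushCovector, ContinuousLinearMap.comp_apply,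
        inverse_chartDeriv_apply hx]
      rfl
    exact (congrArg₂ (· + ·) h1 h2).trans h

/-- A transitive twisted Jacobi structure with a covector field annihilated by `Λ^#` comes from a
twisted contact structure. -/
theorem IsTwistedJacobi.isTwistedContact (hJ : IsTwistedJacobi Λ E ω) (hT : IsTransitive Λ E)
    {n : ℕ} (hdim : Module.finrank ℝ V = 2 * n + 1) (hϑ : ∀ x, sharp (Λ x) (ϑ x) = 0)
    (hϑE : ∀ x, ϑ x (E x) = 1) :
    IsTwistedContact n ϑ ω ∧ IsInducedByContact Λ E ϑ ω := by
  have hsource : ∀ (x : M) {y : V}, y ∈ (extChartAt 𝓘(ℝ, V) x).target →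
      (extChartAt 𝓘(ℝ, V) x).symm y ∈ (extChartAt 𝓘(ℝ, V) x).source :=
    fun x y hy => (extChartAt 𝓘(ℝ, V) x).map_target hy
  have hϑ' : ∀ x, ∀ y ∈ (extChartAt 𝓘(ℝ, V) x).target,
      sharp (pushBivector Λ x ((extChartAt 𝓘(ℝ, V) x).symm y))
        (pushCovector ϑ x ((extChartAt 𝓘(ℝ, V) x).symm y)) = 0 := fun x y hy => by
    rw [sharp_pushBivector_pushCovector (hsource x hy), hϑ, map_zero]
  have hϑE' : ∀ x, ∀ y ∈ (extChartAt 𝓘(ℝ, V) x).target,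
      pushCovector ϑ x ((extChartAt 𝓘(ℝ, V) x).symm y)
        (pushVector E x ((extChartAt 𝓘(ℝ, V) x).symm y)) = 1 := fun x y hy => by
    rw [pushCovector_pushVector (hsource x hy), hϑE]
  have hϑs := fun x => contDiffOn_contactCovector (hJ.contDiffOn_pair x)
    (fun y hy => ((hT.anchorSurjective _).push (hsource x hy)).jacobiSharp_bijective
      (hϑ' x y hy) (hϑE' x y hy)) (hϑ' x) (hϑE' x)
  have hϑs' : ϑ.toForm.IsSmooth := CovectorField.toForm_isSmooth_of_push hϑs
  have htarget := fun x : M => extChartAt_target_mem_nhds (I := 𝓘(ℝ, V)) x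
  have hmem := fun x : M => mem_extChartAt_target (I := 𝓘(ℝ, V)) x
  have key : ∀ (x : M) (b c : (TangentSpace 𝓘(ℝ, V) x →L[ℝ] ℝ) × ℝ), b.1 (E x) = 0 →
      c.1 (E x) = 0 → (ϑ.toForm.d x + ω x)
        ![(jacobiSharp (Λ x) (E x) b).1, (jacobiSharp (Λ x) (E x) c).1] =
        c.1 (jacobiSharp (Λ x) (E x) b).1 := fun x b c hb hc => by
    have hx := mem_extChartAt_source (I := 𝓘(ℝ, V)) x
    have hxx := (extChartAt 𝓘(ℝ, V) x).left_inv hx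
    have hone : DifferentiableAt ℝ
        (fun y => oneForm (pushCovector ϑ x ((extChartAt 𝓘(ℝ, V) x).symm y)))
        (extChartAt 𝓘(ℝ, V) x x) :=
      differentiableAt_of_contDiffOn_target <| contDiffOn_alternating fun v =>
        (hϑs x).clm_apply contDiffOn_const
    have hE0 : ∀ b : (TangentSpace 𝓘(ℝ, V) x →L[ℝ] ℝ) × ℝ, b.1 (E x) = 0 →
        (dualProd (chartDeriv x x).inverse b).1 (pushVector E x
          ((extChartAt 𝓘(ℝ, V) x).symm (extChartAt 𝓘(ℝ, V) x x))) = 0 := fun b hb => by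
      rw [hxx]
      exact (congrArg b.1 (inverse_chartDeriv_apply hx (E x))).trans hb
    have h := (hJ.twistedJacobiEqAt x).extDeriv_contactCovector
      (differentiableAt_of_contDiffOn_target (hJ.contDiffOn_pair x))
      (differentiableAt_of_contDiffOn_target (hϑs x)) hone
      (Filter.mem_of_superset (htarget x) (hϑ' x)) (Filter.mem_of_superset (htarget x) (hϑE' x))
      (hE0 b hb) (hE0 c hc)
    have hS : ∀ b, (jacobiSharp (pushBivector Λ x ((extChartAt 𝓘(ℝ, V) x).symm
        (extChartAt 𝓘(ℝ, V) x x))) (pushVector E x ((extChartAt 𝓘(ℝ, V) x).symm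
        (extChartAt 𝓘(ℝ, V) x x))) (dualProd (chartDeriv x x).inverse b)).1 =
        chartDeriv x x (jacobiSharp (Λ x) (E x) b).1 := fun b => by
      rw [hxx, jacobiSharp_push]
      have e : dualProd (chartDeriv x x) (dualProd (chartDeriv x x).inverse b) = b := by
        refine Prod.ext ?_ rfl
        ext v
        exact congrArg b.1 (inverse_chartDeriv_apply hx v)
      rw [e]
    rw [hS, hS, inChart_eq_pushForm _ (hmem x), hxx, ContinuousAlternatingMap.add_apply,
      pushForm_two_apply _ hx] at h
    have hd := toForm_d_apply ϑ x ![(jacobiSharp (Λ x) (E x) b).1, (jacobiSharp (Λ x) (E x) c).1]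
    have hd' : (fun i => chartDeriv x x ((![(jacobiSharp (Λ x) (E x) b).1,
        (jacobiSharp (Λ x) (E x) c).1] : Fin 2 → TangentSpace 𝓘(ℝ, V) x) i)) =
        ![chartDeriv x x (jacobiSharp (Λ x) (E x) b).1,
          chartDeriv x x (jacobiSharp (Λ x) (E x) c).1] := by
      ext1 i; fin_cases i <;> rfl
    rw [hd'] at hd
    rw [ContinuousAlternatingMap.add_apply, hd, h]
    exact congrArg c.1 (inverse_chartDeriv_apply hx _)
  -- A preimage of `(v, 0)` under `(Λ, E)^#`: the zero second component says exactly that the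
  -- covector annihilates `E`.
  have hsurj : ∀ (x : M) (v : TangentSpace 𝓘(ℝ, V) x),
      ∃ c : (TangentSpace 𝓘(ℝ, V) x →L[ℝ] ℝ) × ℝ,
        (jacobiSharp (Λ x) (E x) c).1 = v ∧ c.1 (E x) = 0 := fun x v => by
    obtain ⟨c, hc⟩ := ((hT.anchorSurjective x).jacobiSharp_bijective (hϑ x) (hϑE x)).2 (v, 0)
    exact ⟨c, congrArg Prod.fst hc, neg_eq_zero.1 (congrArg Prod.snd hc)⟩
  have hΘE : ∀ (x : M) (v : TangentSpace 𝓘(ℝ, V) x), (ϑ.toForm.d x + ω x) ![E x, v] = 0 :=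
    fun x v => by
      obtain ⟨c, rfl, hc⟩ := hsurj x v
      have h := key x (0, 1) c rfl hc
      have e : (jacobiSharp (Λ x) (E x) (0, 1)).1 = E x := by
        rw [jacobiSharp_fst, map_zero, one_smul, zero_add]
      rw [e, hc] at h
      exact h
  have hΘs : ∀ (x : M) (α : TangentSpace 𝓘(ℝ, V) x →L[ℝ] ℝ) (v : TangentSpace 𝓘(ℝ, V) x),
      (ϑ.toForm.d x + ω x) ![sharp (Λ x) α, v] = -(α v - α (E x) * ϑ x v) := fun x α v => by
    obtain ⟨c, rfl, hc⟩ := hsurj x v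
    -- Subtracting this multiple of `ϑ` makes `key` applicable without changing `Λ^# α`.
    have hb : (α - α (E x) • ϑ x) (E x) = 0 := by simp [hϑE]
    have h := key x (α - α (E x) • ϑ x, 0) c hb hc
    have e : (jacobiSharp (Λ x) (E x) (α - α (E x) • ϑ x, 0)).1 = sharp (Λ x) α := by
      rw [jacobiSharp_fst, map_sub, map_smul, hϑ, zero_smul, smul_zero, sub_zero, add_zero]
    rw [e] at h
    rw [h, jacobiSharp_fst, map_add, map_add, map_smul, map_smul, hϑE, apply_sharp_swap,
      apply_sharp_swap (Λ x) c.1 (ϑ x), hϑ, map_zero]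
    simp only [smul_eq_mul]
    ring
  refine ⟨⟨hdim, hϑs', hJ.smooth_form, fun x => ?_⟩, ⟨hϑE, hΘE, hϑ, hΘs⟩⟩
  refine wedge_oneForm_wedgePow_ne_zero (E := E x) hdim (hϑE x) (hΘE x) fun u hu hperp => ?_
  -- For `u` in `ker ϑ` the scalar part of `b` is zero, so `u = Λ^# b.1` and `i(u)Θ = -b.1`; hence
  -- `b.1 = 0`.
  obtain ⟨b, rfl, hb⟩ := hsurj x u
  have h1 : b.2 = 0 := by
    rw [jacobiSharp_fst, map_add, map_smul, hϑE, apply_sharp_swap, hϑ] at hu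
    simpa using hu
  have h2 : b.1 = 0 := by
    ext v
    have := hΘs x b.1 v
    rw [hb, zero_mul, sub_zero] at this
    have hp := hperp v
    rw [jacobiSharp_fst, h1, zero_smul, add_zero, this] at hp
    simpa using hp
  rw [jacobiSharp_fst, h1, h2, map_zero, zero_smul, add_zero]

end Transitive

end TwistedJacobi

open TwistedJacobi in
theorem proposition3p1 {V : Type*} [NormedAddCommGroup V] [NormedSpace ℝ V]
    [FiniteDimensional ℝ V] {M : Type*} [TopologicalSpace M] [ChartedSpace V M]
    [IsManifold 𝓘(ℝ, V) (⊤ : ℕ∞) M]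
    (Λ : BivectorField V M) (E : VField V M) (ω : Form V M 2)
    (hJ : IsTwistedJacobi Λ E ω) (hT : IsTransitive Λ E) :
    (Even (Module.finrank ℝ V) →
      ∃ (ϑ : CovectorField V M) (Θ : Form V M 2),
        IsTwistedLCS ϑ Θ ω ∧ IsInducedByLCS Λ E ϑ Θ ∧ ∀ x, E x = sharp (Λ x) (ϑ x)) ∧
    (∀ n : ℕ, Module.finrank ℝ V = 2 * n + 1 →
      ∃ ϑ : CovectorField V M, IsTwistedContact n ϑ ω ∧ IsInducedByContact Λ E ϑ ω) := by
  constructor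
  · intro heven
    have hinj := fun x => (hT.anchorSurjective x).sharp_injective heven
    -- An arbitrary pointwise choice is harmless: injectivity of `Λ^#` makes `ϑ` unique, and
    -- smoothness follows from the equation that it solves.
    choose ϑ hϑ using fun x => (hT.anchorSurjective x).exists_sharp_eq heven
    choose Θ hΘ using fun x => exists_two_form_of_sharp_injective (hinj x)
    refine ⟨ϑ, Θ, hJ.isTwistedLCS heven hinj hϑ hΘ, ⟨fun x v => ?_, hΘ⟩, fun x => (hϑ x).symm⟩
    rw [← hϑ]
    exact hΘ x _ v
  · intro n hn
    choose ϑ hϑ hϑE using fun x => (hT.anchorSurjective x).exists_contactCovector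
      (show Odd (Module.finrank ℝ V) from ⟨n, hn⟩)
    exact ⟨ϑ, hJ.isTwistedContact hT hn hϑ hϑE⟩
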